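/- Let $H$ be a Hermitian matrix, let $L_1,\dots,L_J$ be arbitrary matrices on a finite-dimensional complex Hilbert space, let $\rho_0$ be a density matrix (positive semidefinite, trace one) and let $O$ be a Hermitian matrix. Write $\|\cdot\|$ for the operator norm of a matrix and $$\mathcal L\rho=-i[H,\rho]+\sum_j\Big(L_j\rho L_j^\dagger-\tfrac12\{L_j^\dagger L_j,\rho\}\Big),\qquad A=-iH-\tfrac12\sum_jL_j^\dagger L_j .$$ For $\tau\ge0$ let one step of the Kraus-form scheme be $$\mathcal K(\tau)\rho=F_0\rho F_0^\dagger+\sum_jF_j\rho F_j^\dagger,\qquad F_0=I+\tau A,\quad F_j=\sqrt\tau\,L_j ,$$ so that $\mathcal K(\tau)=I+\tau\mathcal L+\tau^2\mathcal M_2$ with $\mathcal M_2\rho=A\rho A^\dagger$. For $T\ge0$ and small $\tau>0$ put $\rho_\tau(T)=\mathcal K(\tau)^{T/\tau}\rho_0:=\exp\!\big(\tfrac T\tau\log\mathcal K(\tau)\big)\rho_0$, where $\log\mathcal K(\tau)=\sum_{m\ge0}\frac{(-1)^m}{m+1}(\mathcal K(\tau)-I)^{m+1}$, and $\rho_{\tau=0}(T)=e^{T\mathcal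 L}\rho_0$. Let $f(\tau)=\operatorname{Tr}(\rho_\tau(T)O)$. Let $l\ge1$ satisfy $2\|H\|+2\sum_j\|L_j\|^2\le l$, and let $B=\sup\{\|\mathcal M_2X\|_1: X=X^\dagger,\ \|X\|_1\le1\}$ be the norm of $\mathcal M_2$ induced by the trace norm $\|\cdot\|_1$. Put $$C_1=\max\{B,\,l(e+1),\,1\},\qquad C_2\ge(e+1)\log C_1,\qquad \sigma=2e\|O\|,\qquad \nu=2C_1C_2,$$ and let $0<\tau_{\max}\le 1/(2\nu)$. Derivatives at end points of intervals are one-sided. (a) If $0\le T\le1$, then for all $\tau\in(0,\tau_{\max}]$ the series for $\log\mathcal K(\tau)$ converges, and $\rho_\tau(T)=\mathcal K(\tau)^N\rho_0$ whenever $N\tau=T$ with $N\in\mathbb N$. The function $f$ is $C^\infty$ and belongs to the Gevrey class of order $1$ on $[0,\tau_{\max}]$, and $$|f^{(k)}(\tau)|\le\sigma\,\nu^k\,k!\qquad\text{for all }\tau\in[0,\tau_{\max}],\ k\ge1 .$$ (b) If $T\ge1$, put $\lambda_T=T^2\max\{1,\log T\}$ (so $\lambda_T=T^2\log T$ for $T\ge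 e$). Let $\hat f(\tau)=\operatorname{Tr}(\hat\rho_\tau(1)O)$, where $\hat\rho_\tau(1)$ is defined as above at final time $1$ from the rescaled data $TH$, $\sqrt T\,L_j$, whose generator is $T\mathcal L$ (equation $\frac{d}{ds}\hat\rho=T\mathcal L\hat\rho$ for $\hat\rho(s)=\rho(sT)$). Then the assertions of (a) hold for $\hat f$ (with $T$ replaced by $1$ and the scheme by the rescaled one) on $[0,\tau_{\max}/\lambda_T]$ with $\nu$ replaced by $\nu\lambda_T$: $$|\hat f^{(k)}(\tau)|\le\sigma\,(\nu\lambda_T)^k\,k!\qquad\text{for all }\tau\in[0,\tau_{\max}/\lambda_T],\ k\ge1 ,$$ and the same assertions hold, with the same constant and on the same interval, for the function $f(\tau)=\operatorname{Tr}(\rho_\tau(T)O)$ of the unscaled scheme run up to time $T$. -/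

import Mathlib

open scoped Matrix Matrix.Norms.L2Operator ComplexOrder ContDiff Nat

noncomputable section

namespace LindbladKraus

variable {n ι : Type*} [Fintype n] [DecidableEq n] [Fintype ι]

/-- Superoperators: linear maps on the space of complex `n × n` matrices. (All linear maps are
continuous here; the continuous ones are used because they carry a topology.) Throughout, `‖A‖`
for a matrix `A` is the operator norm with respect to the Euclidean norm. -/
abbrev SuperOp (n : Type*) [Fintype n] [DecidableEq n] : Type _ :=
  Matrix n n ℂ →L[ℂ] Matrix n n ℂ

/-- The superoperator `X ↦ A X B`. -/
def sandwich (A B : Matrix n n ℂ) : SuperOp n :=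
  ContinuousLinearMap.mulLeftRight ℂ (Matrix n n ℂ) A B

@[simp] lemma sandwich_apply (A B X : Matrix n n ℂ) : sandwich A B X = A * X * B := rfl

/-- The trace norm (Schatten 1-norm), the sum of the singular values of `X`, i.e. of the square
roots of the eigenvalues of `Xᴴ * X`. -/
def traceNorm (X : Matrix n n ℂ) : ℝ :=
  ∑ i, √((Matrix.isHermitian_conjTranspose_mul_self X).eigenvalues i)

/-- The norm of a superoperator acting on Hermitian matrices, induced by the trace norm. -/
def superNorm (M : SuperOp n) : ℝ :=
  sSup {r : ℝ | ∃ X : Matrix n n ℂ, X.IsHermitian ∧ traceNorm X ≤ 1 ∧ r = traceNorm (M X)}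

/-- The Lindblad generator
`ρ ↦ -i[H, ρ] + ∑ j, (L j ρ (L j)ᴴ - ½ {(L j)ᴴ L j, ρ})`. -/
def lindbladian (H : Matrix n n ℂ) (L : ι → Matrix n n ℂ) : SuperOp n :=
  (-Complex.I) • (sandwich H 1 - sandwich 1 H) +
    ∑ j, (sandwich (L j) (L j)ᴴ -
      (1 / 2 : ℂ) • (sandwich ((L j)ᴴ * L j) 1 + sandwich 1 ((L j)ᴴ * L j)))

/-- `2 ‖H‖ + 2 ∑ j, ‖L j‖ ^ 2`, the standard bound on the norm of the Lindblad generator. -/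
def lindbladBound (H : Matrix n n ℂ) (L : ι → Matrix n n ℂ) : ℝ :=
  2 * ‖H‖ + 2 * ∑ j, ‖L j‖ ^ 2

/-- The matrix `A = -iH - ½ ∑ j, (L j)ᴴ L j`. -/
def effective (H : Matrix n n ℂ) (L : ι → Matrix n n ℂ) : Matrix n n ℂ :=
  (-Complex.I) • H - (1 / 2 : ℂ) • ∑ j, (L j)ᴴ * L j

/-- The Kraus operator `F₀ = I + τ A`. -/
def krausZero (H : Matrix n n ℂ) (L : ι → Matrix n n ℂ) (τ : ℝ) : Matrix n n ℂ :=
  1 + (τ : ℂ) • effective H L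

/-- The Kraus operators `F j = √τ L j`. -/
def krausJump (L : ι → Matrix n n ℂ) (τ : ℝ) (j : ι) : Matrix n n ℂ :=
  ((√τ : ℝ) : ℂ) • L j

/-- One step of the Kraus-form scheme with step size `τ`:
`𝒦(τ) ρ = F₀ ρ F₀ᴴ + ∑ j, F j ρ (F j)ᴴ`. -/
def krausStep (H : Matrix n n ℂ) (L : ι → Matrix n n ℂ) (τ : ℝ) : SuperOp n :=
  sandwich (krausZero H L τ) (krausZero H L τ)ᴴ +
    ∑ j, sandwich (krausJump L τ j) (krausJump L τ j)ᴴ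

/-- The coefficient `ℳ₂` of `τ ^ 2` in `𝒦(τ)`, namely `ρ ↦ A ρ Aᴴ`;
see `krausStep_eq` below. -/
def secondOrder (H : Matrix n n ℂ) (L : ι → Matrix n n ℂ) : SuperOp n :=
  sandwich (effective H L) (effective H L)ᴴ

/-- The expansion `𝒦(τ) = I + τ 𝓛 + τ² ℳ₂`. -/
lemma krausStep_eq (H : Matrix n n ℂ) (hH : H.IsHermitian) (L : ι → Matrix n n ℂ)
    {τ : ℝ} (hτ : 0 ≤ τ) :
    krausStep H L τ =
      1 + (τ : ℂ) • lindbladian H L + ((τ : ℂ) ^ 2) • secondOrder H L := by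
  have hs : ((√τ : ℝ) : ℂ) * ((√τ : ℝ) : ℂ) = τ := by
    rw [← Complex.ofReal_mul, Real.mul_self_sqrt hτ]
  have hE : (effective H L)ᴴ
      = Complex.I • H - (1 / 2 : ℂ) • ∑ j, (L j)ᴴ * L j := by
    simp [effective, Matrix.conjTranspose_sub, Matrix.conjTranspose_smul, hH.eq,
      Matrix.conjTranspose_sum, Matrix.conjTranspose_mul]
  apply ContinuousLinearMap.ext
  intro X
  have hj : ∀ j, sandwich (krausJump L τ j) (krausJump L τ j)ᴴ X
      = (τ : ℂ) • (L j * X * (L j)ᴴ) := by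
    intro j
    simp only [krausJump, sandwich_apply, Matrix.conjTranspose_smul, Complex.star_def,
      Complex.conj_ofReal, smul_mul_assoc, mul_smul_comm, smul_smul, hs]
  have h0 : (krausZero H L τ)ᴴ = 1 + (τ : ℂ) • (effective H L)ᴴ := by
    simp [krausZero, Matrix.conjTranspose_add, Matrix.conjTranspose_smul]
  have hl : lindbladian H L X
      = effective H L * X + X * (effective H L)ᴴ + ∑ j, L j * X * (L j)ᴴ := by
    rw [hE]
    simp only [lindbladian, effective, add_apply, smul_apply, sub_apply,
      FunLike.coe_sum, Finset.sum_apply, sandwich_apply, one_mul,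
      mul_one, sub_mul, mul_sub, Finset.sum_sub_distrib, smul_mul_assoc, mul_smul_comm,
      Finset.sum_mul, Finset.mul_sum, smul_sub, smul_add, Finset.sum_add_distrib,
      Finset.smul_sum]
    simp only [neg_smul]
    abel
  simp only [krausStep, add_apply, FunLike.coe_sum, Finset.sum_apply, hj, smul_apply, hl]
  rw [sandwich_apply, h0]
  simp only [sandwich_apply, krausZero, secondOrder, ← Finset.smul_sum,
    one_apply_eq_self, add_mul, mul_add, one_mul, mul_one, smul_mul_assoc,
    mul_smul_comm, smul_add, smul_smul, pow_two]
  abel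

/-- The terms of the logarithm series
`log M = ∑ m ≥ 0, (-1) ^ m / (m + 1) (M - I) ^ (m + 1)`. -/
def logTerm (M : SuperOp n) (m : ℕ) : SuperOp n :=
  ((-1 : ℂ) ^ m / (m + 1)) • (M - 1) ^ (m + 1)

/-- The logarithm of a superoperator near the identity. -/
def superLog (M : SuperOp n) : SuperOp n := ∑' m, logTerm M m

/-- The approximate state `ρ_τ(T) = 𝒦(τ)^{T/τ} ρ₀` as a function of the continuous step size `τ`,
where `𝒦(τ)^{T/τ} = exp ((T/τ) log 𝒦(τ))`, and `ρ_0(T) = exp (T 𝓛) ρ₀` is the exact solution. -/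
def rhoApprox (H : Matrix n n ℂ) (L : ι → Matrix n n ℂ) (ρ₀ : Matrix n n ℂ) (T τ : ℝ) :
    Matrix n n ℂ :=
  if τ = 0 then NormedSpace.exp ((T : ℂ) • lindbladian H L) ρ₀
  else NormedSpace.exp (((T / τ : ℝ) : ℂ) • superLog (krausStep H L τ)) ρ₀

/-- The observable `f(τ) = Tr (ρ_τ(T) O)`. -/
def observable (H : Matrix n n ℂ) (L : ι → Matrix n n ℂ) (ρ₀ O : Matrix n n ℂ) (T τ : ℝ) : ℂ :=
  (rhoApprox H L ρ₀ T τ * O).trace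

/-- `ρ_τ(T)` is well defined for all step sizes in `(0, R]` (the logarithm series converges), and
whenever an integer number `N` of steps of size `τ` makes up the time `T`, it is the state
`𝒦(τ) ^ N ρ₀` that the scheme produces. -/
def AgreesWithScheme (H : Matrix n n ℂ) (L : ι → Matrix n n ℂ) (ρ₀ : Matrix n n ℂ)
    (T R : ℝ) : Prop :=
  ∀ τ : ℝ, 0 < τ → τ ≤ R →
    Summable (logTerm (krausStep H L τ)) ∧
    ∀ N : ℕ, (N : ℝ) * τ = T → rhoApprox H L ρ₀ T τ = (krausStep H L τ ^ N) ρ₀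

/-- `C₁ = max {‖ℳ₂‖, l (e + 1), 1}`. -/
def constC₁ (H : Matrix n n ℂ) (L : ι → Matrix n n ℂ) (l : ℝ) : ℝ :=
  max (max (superNorm (secondOrder H L)) (l * (Real.exp 1 + 1))) 1

/-- The Gevrey class of order `s` on `[0, R]`, with one-sided derivatives at the end points. -/
def IsGevreyOn (s : ℝ) (f : ℝ → ℂ) (R : ℝ) : Prop :=
  ContDiffOn ℝ ∞ f (Set.Icc 0 R) ∧
    ∃ C ν : ℝ, ∀ k : ℕ, ∀ τ ∈ Set.Icc 0 R,
      ‖iteratedDerivWithin k f (Set.Icc 0 R) τ‖ ≤ C * ν ^ k * (k ! : ℝ) ^ s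

/-- `|f^{(k)}(τ)| ≤ σ ν ^ k k!` for `τ ∈ [0, R]` and `k ≥ 1`. -/
def GevreyBound (f : ℝ → ℂ) (σ ν R : ℝ) : Prop :=
  ∀ k : ℕ, 1 ≤ k → ∀ τ ∈ Set.Icc 0 R,
    ‖iteratedDerivWithin k f (Set.Icc 0 R) τ‖ ≤ σ * ν ^ k * (k ! : ℝ)

/-- The rescaled Hamiltonian `T H`; together with `scaledL` it generates `T 𝓛`. -/
def scaledH (H : Matrix n n ℂ) (T : ℝ) : Matrix n n ℂ := (T : ℂ) • H

/-- The rescaled jump operators `√T L j`. -/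
def scaledL (L : ι → Matrix n n ℂ) (T : ℝ) (j : ι) : Matrix n n ℂ := ((√T : ℝ) : ℂ) • L j

/-- Rescaling the data of the Lindblad equation multiplies the generator by `T`. -/
lemma lindbladian_scaled (H : Matrix n n ℂ) (L : ι → Matrix n n ℂ) {T : ℝ} (hT : 0 ≤ T) :
    lindbladian (scaledH H T) (scaledL L T) = (T : ℂ) • lindbladian H L := by
  have hs : ((√T : ℝ) : ℂ) * ((√T : ℝ) : ℂ) = T := by
    rw [← Complex.ofReal_mul, Real.mul_self_sqrt hT]
  apply ContinuousLinearMap.ext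
  intro X
  simp only [lindbladian, scaledH, scaledL, add_apply, smul_apply, sub_apply,
    FunLike.coe_sum, Finset.sum_apply, sandwich_apply, one_mul, mul_one,
    Matrix.conjTranspose_smul, smul_mul_assoc, mul_smul_comm, smul_smul, smul_add, smul_sub,
    Finset.smul_sum, Complex.star_def, Complex.conj_ofReal, hs]
  simp only [mul_comm]

/-- The constant `T² max {1, log T}` by which `ν` grows and the step-size interval shrinks. -/
def timeFactor (T : ℝ) : ℝ := T ^ 2 * max 1 (Real.log T)

end LindbladKraus

end

/-!
The proof works in the Heisenberg picture and extends `f` to complex step sizes. With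
`A = -iH - ½ ∑ j, (L j)ᴴ L j`, the superoperators dual to `𝓛` and `ℳ₂` for the trace pairing are
`G Y = Aᴴ Y + Y A + ∑ j, (L j)ᴴ Y (L j)` and `M Y = Aᴴ Y A`, and
`f(τ) = Tr (ρ₀ exp (T Λ(τ)) O)` with `Λ(z) = z⁻¹ log (1 + z G + z² M)` (`observable_eq`). The series
of `Λ` has no singularity at `z = 0`, where its value is `G`, so the right-hand side is holomorphic
in `z` near `0`. Since a density matrix pairs with a matrix `Y` to at most `‖Y‖`, it is bounded by
`‖exp (T Λ(z))‖ ‖O‖` in the operator norm. Once this is known to be at most `2 e ‖O‖` for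
`|z| ≤ 3 / (2 ν)`, Cauchy's estimates on circles of radius `1 / ν` around the points of
`[0, 1 / (2 ν)]` give the claim (`gevrey_of_differentiableOn`).

The bound on the exponential must not involve `exp ‖T G‖`. For `h ≥ 0` the map
`1 + h G + h² M` is completely positive and sends `1` to `1 + h² Aᴴ A`, and a completely positive
map attains its norm at `1`; hence `‖1 + h G‖ ≤ 1 + O(h²)`, and `exp (T G + E)` has norm at most
`exp ‖E‖` (`norm_one_add_smul_dualLindbladian_le`, `norm_exp_le_of_norm_one_add_smul_le`). It
remains to see that `E = T (Λ(z) - G)` has norm at most `1 + log 2` (`norm_exp_smul_logQuotient_le`).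
Its main terms are `T z M` and `T z G² / 2`. The same norm identity for completely positive maps
gives `‖G‖ ≤ 4 ‖A‖` (`norm_dualLindbladian_le`), so both are of size `T |z| ‖A‖²`; and rank-one
projections show `‖A‖² ≤ ‖ℳ₂‖ ≤ C₁` (`norm_effective_sq_le_superNorm`). As `ν = 2 C₁ C₂` with
`C₂ ≥ e + 2`, this is small for `|z| ≤ 3 / (2 ν)`. Rescaling by `T` replaces `A` by `T A` and the
final time by `1`, so in part (b) the quantities to be controlled are `T² ‖A‖²` and `T ‖A‖²`, both
at most `λ_T ‖A‖²`.

That `exp (N log 𝒦)` is `𝒦 ^ N` follows from `exp (log (1 + X)) = 1 + X` in a Banach algebra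
(`exp_log_series`).
-/

noncomputable section

namespace LindbladKraus

/-! ### Exponential and logarithm in a Banach algebra -/

section BanachAlgebra

variable {𝔸 : Type*} [NormedRing 𝔸] [NormedAlgebra ℂ 𝔸]

lemma exp_natCast_smul [CompleteSpace 𝔸] (x : 𝔸) (N : ℕ) :
    NormedSpace.exp ((N : ℂ) • x) = NormedSpace.exp x ^ N := by
  let : NormedAlgebra ℚ 𝔸 := NormedAlgebra.restrictScalars ℚ ℂ 𝔸
  rw [Nat.cast_smul_eq_nsmul, NormedSpace.exp_nsmul]

/-- A logarithmic-norm estimate: `exp G = exp (G / N) ^ N`, and for large `N` the factor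
`exp (G / N)` differs from `1 + G / N` by `o(1 / N)`. -/
lemma norm_exp_le_of_norm_one_add_smul_le [CompleteSpace 𝔸] {G : 𝔸} {δ c : ℝ}
    (hG : ∀ h : ℝ, 0 ≤ h → ‖1 + (h : ℂ) • G‖ ≤ 1 + h * δ + c * h ^ 2) :
    ‖NormedSpace.exp G‖ ≤ Real.exp δ := by
  have hlim : ∀ ε > 0, ‖NormedSpace.exp G‖ ≤ Real.exp (δ + 2 * ε) := by
    intro ε hε
    have hd : HasDerivAt (fun z : ℂ => NormedSpace.exp (z • G)) G 0 := by
      simpa using hasDerivAt_exp_smul_const (𝕂 := ℂ) G (0 : ℂ)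
    have hd' : HasDerivAt (fun h : ℝ => NormedSpace.exp ((h : ℂ) • G)) G 0 := by
      have : HasDerivAt (fun z : ℂ => NormedSpace.exp (z • G)) G ((0 : ℝ) : ℂ) := by simpa using hd
      simpa [Function.comp_def] using this.scomp (0 : ℝ) Complex.ofRealCLM.hasDerivAt
    have h1 := (hasDerivAt_iff_isLittleO.mp hd').def hε
    have htend : Filter.Tendsto (fun N : ℕ => 1 / ((N : ℝ) + 1)) Filter.atTop (nhds 0) :=
      tendsto_one_div_add_atTop_nhds_zero_nat
    have h2 := htend.eventually h1
    have h3 : ∀ᶠ N : ℕ in Filter.atTop, c * (1 / ((N : ℝ) + 1)) < ε := by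
      have := htend.const_mul c
      rw [mul_zero] at this
      exact this.eventually (gt_mem_nhds hε)
    obtain ⟨N, hN2, hN3⟩ := (h2.and h3).exists
    set h : ℝ := 1 / ((N : ℝ) + 1) with hh
    have hpos : 0 < h := by positivity
    have hNh : ((N + 1 : ℕ) : ℝ) * h = 1 := by
      rw [hh]; push_cast; field_simp
    simp only [Complex.ofReal_zero, zero_smul, NormedSpace.exp_zero, sub_zero, Real.norm_eq_abs,
      abs_of_pos hpos] at hN2
    have hstep : ‖NormedSpace.exp ((h : ℂ) • G)‖ ≤ Real.exp (h * (δ + 2 * ε)) := by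
      calc ‖NormedSpace.exp ((h : ℂ) • G)‖
          = ‖(NormedSpace.exp ((h : ℂ) • G) - 1 - h • G) + (1 + (h : ℂ) • G)‖ := by
            congr 1
            rw [Complex.coe_smul]; abel
        _ ≤ ε * h + (1 + h * δ + c * h ^ 2) :=
            (norm_add_le _ _).trans (add_le_add hN2 (hG h hpos.le))
        _ ≤ h * (δ + 2 * ε) + 1 := by nlinarith
        _ ≤ _ := Real.add_one_le_exp _
    have hpow : NormedSpace.exp G = NormedSpace.exp ((h : ℂ) • G) ^ (N + 1) := by
      rw [← exp_natCast_smul, smul_smul]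
      have : ((N + 1 : ℕ) : ℂ) * (h : ℂ) = 1 := by exact_mod_cast hNh
      rw [this, one_smul]
    rw [hpow]
    calc ‖NormedSpace.exp ((h : ℂ) • G) ^ (N + 1)‖
        ≤ ‖NormedSpace.exp ((h : ℂ) • G)‖ ^ (N + 1) := norm_pow_le' _ N.succ_pos
      _ ≤ Real.exp (h * (δ + 2 * ε)) ^ (N + 1) := by gcongr
      _ = Real.exp (δ + 2 * ε) := by
        rw [← Real.exp_nat_mul, ← mul_assoc, hNh, one_mul]
  have ht : Filter.Tendsto (fun ε : ℝ => Real.exp (δ + 2 * ε)) (nhdsWithin 0 (Set.Ioi 0))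
      (nhds (Real.exp δ)) := by
    have : Continuous fun ε : ℝ => Real.exp (δ + 2 * ε) := by fun_prop
    simpa using (this.tendsto 0).mono_left nhdsWithin_le_nhds
  exact ge_of_tendsto ht (eventually_mem_nhdsWithin.mono hlim)

lemma norm_log_coeff_le (m : ℕ) : ‖((-1 : ℂ) ^ m / (m + 1))‖ ≤ 1 := by
  rw [norm_div, norm_pow, norm_neg, norm_one, one_pow]
  have : ‖(m : ℂ) + 1‖ = (m : ℝ) + 1 := by
    rw [← Nat.cast_succ, Complex.norm_natCast]; push_cast; ring
  rw [this, div_le_one (by positivity)]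
  linarith [m.cast_nonneg (α := ℝ)]

lemma summable_log_series [CompleteSpace 𝔸] {X : 𝔸} (hX : ‖X‖ < 1) :
    Summable fun m : ℕ => ((-1 : ℂ) ^ m / (m + 1)) • X ^ (m + 1) := by
  refine Summable.of_norm_bounded (g := fun m => ‖X‖ ^ (m + 1)) ?_ fun m => ?_
  · exact (summable_nat_add_iff 1).mpr (summable_geometric_of_lt_one (norm_nonneg _) hX)
  · rw [norm_smul]
    calc _ ≤ 1 * ‖X‖ ^ (m + 1) :=
          mul_le_mul (norm_log_coeff_le m) (norm_pow_le' _ m.succ_pos) (norm_nonneg _) zero_le_one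
      _ = _ := one_mul _

/-- `exp (log (1 + X)) = 1 + X`: the derivative of `exp (-log (1 + t X)) (1 + t X)` in `t` vanishes
on a disc that contains `0` and `1`. -/
lemma exp_log_series [CompleteSpace 𝔸] {X : 𝔸} (hX : ‖X‖ < 1) :
    NormedSpace.exp (∑' m : ℕ, ((-1 : ℂ) ^ m / (m + 1)) • X ^ (m + 1)) = 1 + X := by
  let : NormedAlgebra ℚ 𝔸 := NormedAlgebra.restrictScalars ℚ ℂ 𝔸
  obtain ⟨r, hr1, hrX⟩ : ∃ r : ℝ, 1 < r ∧ r * ‖X‖ < 1 := by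
    rcases (norm_nonneg X).eq_or_lt with h0 | h0
    · exact ⟨2, one_lt_two, by rw [← h0]; norm_num⟩
    · obtain ⟨r, h1, h2⟩ := exists_between ((one_lt_div h0).mpr hX)
      exact ⟨r, h1, (lt_div_iff₀ h0).mp h2⟩
  have hr0 : 0 < r := by linarith
  set D : Set ℂ := Metric.ball 0 r with hD
  -- The logarithm of `1 + t X` and its derivative, term by term.
  set y : ℕ → ℂ → 𝔸 := fun m t => (((-1 : ℂ) ^ m / (m + 1)) * t ^ (m + 1)) • X ^ (m + 1) with hy
  set y' : ℕ → ℂ → 𝔸 := fun m t => ((-1 : ℂ) ^ m * t ^ m) • X ^ (m + 1) with hy'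
  have hyd : ∀ m t, HasDerivAt (y m) (y' m t) t := by
    intro m t
    have h := ((hasDerivAt_pow (m + 1) t).const_mul ((-1 : ℂ) ^ m / (m + 1))).smul_const
      (X ^ (m + 1))
    have hm : ((m : ℂ) + 1) ≠ 0 := Nat.cast_add_one_ne_zero m
    have hc : (-1 : ℂ) ^ m / (m + 1) * (((m + 1 : ℕ) : ℂ) * t ^ (m + 1 - 1))
        = (-1) ^ m * t ^ m := by
      rw [Nat.add_sub_cancel]
      push_cast
      field_simp
    rw [hc] at h
    exact h
  have hu : Summable fun m : ℕ => (r * ‖X‖) ^ m * ‖X‖ :=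
    (summable_geometric_of_lt_one (by positivity) hrX).mul_right _
  have hbound : ∀ m t, t ∈ D → ‖y' m t‖ ≤ (r * ‖X‖) ^ m * ‖X‖ := by
    intro m t ht
    have ht' : ‖t‖ ≤ r := (mem_ball_zero_iff.mp ht).le
    rw [hy', norm_smul, norm_mul, norm_pow, norm_pow, norm_neg, norm_one, one_pow, one_mul]
    calc ‖t‖ ^ m * ‖X ^ (m + 1)‖ ≤ r ^ m * ‖X‖ ^ (m + 1) := by
          gcongr; exact norm_pow_le' _ m.succ_pos
      _ = _ := by ring
  have h0D : (0 : ℂ) ∈ D := Metric.mem_ball_self hr0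
  have hconv : Convex ℝ D := convex_ball _ _
  have hy0 : ∀ m, y m 0 = 0 := fun m => by simp [hy]
  have hYd : ∀ t ∈ D, HasDerivAt (fun t => ∑' m, y m t) (∑' m, y' m t) t := fun t ht =>
    hasDerivAt_tsum_of_isPreconnected hu Metric.isOpen_ball hconv.isPreconnected
      (fun m t _ => hyd m t) hbound h0D (by simp [hy0, summable_zero]) ht
  have hy's : ∀ t ∈ D, Summable fun m => y' m t := fun t ht =>
    Summable.of_norm_bounded hu fun m => hbound m t ht
  set Y : ℂ → 𝔸 := fun t => ∑' m, y m t with hY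
  set Y' : ℂ → 𝔸 := fun t => ∑' m, y' m t with hY'
  have hcy : ∀ m t, Commute (y m t) X := fun m t =>
    ((Commute.refl X).pow_left _).smul_left _
  have hcYX : ∀ t, Commute (Y t) X := fun t =>
    Commute.tsum_left X fun m => hcy m t
  have hcYY : ∀ s t, Commute (Y s) (Y t) := fun s t =>
    Commute.tsum_right _ fun m => ((hcYX s).pow_right _).smul_right _
  -- `Y' (1 + t X) = X` is the geometric series.
  have hgeom : ∀ t ∈ D, Y' t * (1 + t • X) = X := by
    intro t ht
    have hs := hy's t ht
    have hshift : ∀ m, y' (m + 1) t = -(y' m t * (t • X)) := by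
      intro m
      simp only [hy', smul_mul_smul_comm, ← pow_succ, ← neg_smul]
      congr 1
      ring
    have h1 : Y' t = X + ∑' m, y' (m + 1) t := by
      rw [hY']
      simp only
      rw [hs.tsum_eq_zero_add]
      simp [hy']
    have h2 : ∑' m, y' (m + 1) t = -(Y' t * (t • X)) := by
      rw [hY']
      simp only
      rw [← hs.tsum_mul_right, ← tsum_neg]
      exact tsum_congr hshift
    rw [mul_add, mul_one]
    nth_rw 1 [h1]
    rw [h2]; abel
  have hexpd : ∀ t ∈ D, HasDerivAt (fun s => NormedSpace.exp (-Y s))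
      (NormedSpace.exp (-Y t) * (-Y' t)) t := by
    intro t ht
    have hfun : (fun s => NormedSpace.exp (-Y s))
        = fun s => NormedSpace.exp (-Y t) * NormedSpace.exp (Y t - Y s) := by
      funext s
      rw [← NormedSpace.exp_add_of_commute]
      · congr 1; abel
      · exact ((Commute.refl _).sub_right (hcYY t s)).neg_left
    -- All values of `Y` commute, so only the derivative of `exp` at `0` is needed.
    rw [hfun]
    have hin : HasDerivAt (fun s => Y t - Y s) (-Y' t) t := by
      simpa using (hYd t ht).const_sub (Y t)
    have hexp : HasFDerivAt (NormedSpace.exp : 𝔸 → 𝔸) (1 : 𝔸 →L[ℂ] 𝔸) (Y t - Y t) := by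
      rw [sub_self]; exact hasFDerivAt_exp_zero
    have := hexp.comp_hasDerivAt t hin
    exact (this.const_mul (NormedSpace.exp (-Y t)))
  have hhd : ∀ t ∈ D, HasDerivAt (fun s => NormedSpace.exp (-Y s) * (1 + s • X)) 0 t := by
    intro t ht
    have h2 : HasDerivAt (fun s : ℂ => 1 + s • X) X t := by
      simpa using ((hasDerivAt_id t).smul_const X).const_add 1
    have h3 := (hexpd t ht).mul h2
    rw [mul_assoc, neg_mul, hgeom t ht, mul_neg, neg_add_cancel] at h3
    exact h3
  have h1D : (1 : ℂ) ∈ D := by rw [hD, mem_ball_zero_iff]; simpa using hr1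
  have hconst := hconv.is_const_of_fderivWithin_eq_zero (𝕜 := ℂ)
    (f := fun s => NormedSpace.exp (-Y s) * (1 + s • X))
    (fun t ht => (hhd t ht).differentiableAt.differentiableWithinAt)
    (fun t ht => by
      have h := (hhd t ht).hasFDerivAt.hasFDerivWithinAt (s := D)
      rw [h.fderivWithin (Metric.isOpen_ball.uniqueDiffWithinAt ht)]
      ext; simp)
    h1D h0D
  have hY0 : Y 0 = 0 := by simp [hY, hy0]
  have hY1 : Y 1 = ∑' m : ℕ, ((-1 : ℂ) ^ m / (m + 1)) • X ^ (m + 1) := by simp [hY, hy]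
  simp only [hY0, neg_zero, NormedSpace.exp_zero, zero_smul, add_zero, mul_one, one_smul] at hconst
  rw [← hY1]
  calc NormedSpace.exp (Y 1) = NormedSpace.exp (Y 1) * (NormedSpace.exp (-Y 1) * (1 + X)) := by
        rw [hconst, mul_one]
    _ = 1 + X := by
        rw [← mul_assoc, ← NormedSpace.exp_add_of_commute (Commute.refl (Y 1)).neg_right,
          add_neg_cancel, NormedSpace.exp_zero, one_mul]

/-! ### The logarithm of `1 + z G + z² M` divided by `z` -/

/-- `z⁻¹ log (1 + z G + z² M)`, with the singularity at `z = 0` removed. -/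
def logQuotient (G M : 𝔸) (z : ℂ) : 𝔸 :=
  ∑' m : ℕ, ((-1 : ℂ) ^ m / (m + 1) * z ^ m) • (G + z • M) ^ (m + 1)

lemma norm_logQuotient_term_le (S : 𝔸) {z : ℂ} {q s : ℝ} (hz : ‖z‖ ≤ q)
    (hs : ‖S‖ ≤ s) (m : ℕ) :
    ‖((-1 : ℂ) ^ m / (m + 1) * z ^ m) • S ^ (m + 1)‖ ≤ (q * s) ^ m * s := by
  have hs0 : 0 ≤ s := (norm_nonneg _).trans hs
  have hq0 : 0 ≤ q := (norm_nonneg _).trans hz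
  rw [norm_smul, norm_mul, norm_pow]
  calc _ ≤ 1 * q ^ m * s ^ (m + 1) := by
        gcongr
        · exact norm_log_coeff_le m
        · exact (norm_pow_le' _ m.succ_pos).trans (by gcongr)
    _ = _ := by ring

lemma logQuotient_zero (G M : 𝔸) : logQuotient G M 0 = G := by
  rw [logQuotient, tsum_eq_single 0]
  · simp
  · intro m hm; simp [hm]

lemma smul_logQuotient (G M : 𝔸) (z : ℂ) :
    z • logQuotient G M z =
      ∑' m : ℕ, ((-1 : ℂ) ^ m / (m + 1)) • (z • G + z ^ 2 • M) ^ (m + 1) := by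
  rw [logQuotient, ← tsum_const_smul'']
  refine tsum_congr fun m => ?_
  rw [pow_two, ← smul_smul z z M, ← smul_add, smul_pow, smul_smul, smul_smul]
  congr 1
  ring

lemma differentiableOn_logQuotient [CompleteSpace 𝔸] {G M : 𝔸} {q s : ℝ}
    (hqs : q * s < 1) (hq : 0 ≤ q)
    (hs : ∀ z : ℂ, ‖z‖ < q → ‖G + z • M‖ ≤ s) :
    DifferentiableOn ℂ (logQuotient G M) (Metric.ball 0 q) := by
  rcases hq.eq_or_lt with rfl | hq'
  · rw [Metric.ball_zero]; exact differentiableOn_empty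
  have hs0 : 0 ≤ s := (norm_nonneg _).trans (hs 0 (by simpa using hq'))
  refine Complex.differentiableOn_tsum_of_summable_norm (u := fun m => (q * s) ^ m * s)
    ((summable_geometric_of_lt_one (by positivity) hqs).mul_right _) (fun m => ?_)
    Metric.isOpen_ball fun m z hz => ?_
  · apply Differentiable.differentiableOn
    fun_prop
  · rw [mem_ball_zero_iff] at hz
    exact norm_logQuotient_term_le _ hz.le (hs z hz) m

lemma differentiableOn_exp_smul_logQuotient [CompleteSpace 𝔸] {G M : 𝔸} {q s : ℝ}
    (hqs : q * s < 1) (hq : 0 ≤ q) (hs : ∀ z : ℂ, ‖z‖ < q → ‖G + z • M‖ ≤ s) (c : ℂ) :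
    DifferentiableOn ℂ (fun z => NormedSpace.exp (c • logQuotient G M z)) (Metric.ball 0 q) := by
  have hexp : Differentiable ℂ (NormedSpace.exp : 𝔸 → 𝔸) := fun x =>
    (NormedSpace.exp_analytic (𝕂 := ℂ) x).differentiableAt
  have hlog := differentiableOn_logQuotient hqs hq hs
  intro z hz
  exact (hexp _).comp_differentiableWithinAt z ((hlog z hz).const_smul c)

/-- The second order of the logarithm is where the factor `1 / 2` comes from; higher orders are
dominated by a geometric series. -/
lemma norm_logQuotient_sub_le [CompleteSpace 𝔸] {G M : 𝔸} {z : ℂ} {q s b : ℝ}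
    (hz : ‖z‖ ≤ q) (hqs : q * s < 1)
    (hs : ‖G + z • M‖ ≤ s) (hM : ‖M‖ ≤ b) :
    ‖logQuotient G M z - G‖ ≤ q * b + q * s ^ 2 / 2 / (1 - q * s) := by
  have hs0 : 0 ≤ s := (norm_nonneg _).trans hs
  have hq0 : 0 ≤ q := (norm_nonneg _).trans hz
  set S := G + z • M with hS
  have hsum : Summable fun m : ℕ => ((-1 : ℂ) ^ m / (m + 1) * z ^ m) • S ^ (m + 1) :=
    Summable.of_norm_bounded ((summable_geometric_of_lt_one (by positivity) hqs).mul_right s)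
      (norm_logQuotient_term_le _ hz hs)
  have htail : ‖∑' m : ℕ, ((-1 : ℂ) ^ (m + 1) / ((m + 1 : ℕ) + 1) * z ^ (m + 1)) •
      S ^ (m + 1 + 1)‖ ≤ q * s ^ 2 / 2 * (1 - q * s)⁻¹ := by
    refine tsum_of_norm_bounded
      ((hasSum_geometric_of_lt_one (by positivity) hqs).mul_left (q * s ^ 2 / 2)) fun m => ?_
    have hc : ‖((-1 : ℂ) ^ (m + 1) / ((m + 1 : ℕ) + 1))‖ ≤ 1 / 2 := by
      rw [norm_div, norm_pow, norm_neg, norm_one, one_pow]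
      have : ‖((m + 1 : ℕ) : ℂ) + 1‖ = (m : ℝ) + 2 := by
        rw [← Nat.cast_succ, Complex.norm_natCast]; push_cast; ring
      rw [this]
      apply one_div_le_one_div_of_le two_pos
      linarith [m.cast_nonneg (α := ℝ)]
    rw [norm_smul, norm_mul, norm_pow]
    calc _ ≤ 1 / 2 * q ^ (m + 1) * s ^ (m + 1 + 1) := by
          gcongr
          exact (norm_pow_le' _ (Nat.succ_pos _)).trans (by gcongr)
      _ = _ := by ring
  have heq : logQuotient G M z - G = z • M +
      ∑' m : ℕ, ((-1 : ℂ) ^ (m + 1) / ((m + 1 : ℕ) + 1) * z ^ (m + 1)) • S ^ (m + 1 + 1) := by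
    rw [logQuotient, ← hS, hsum.tsum_eq_zero_add]
    simp only [pow_zero, Nat.cast_zero, zero_add, div_one, mul_one, one_smul, pow_one]
    rw [hS]; abel
  rw [heq, div_eq_mul_inv _ (1 - q * s)]
  refine (norm_add_le _ _).trans (add_le_add ?_ htail)
  rw [norm_smul]
  gcongr

end BanachAlgebra

/-! ### Operator norm bounds for matrices -/

section Matrices

variable {n κ : Type*} [Fintype n] [DecidableEq n] [Fintype κ]

lemma norm_toEuclideanCLM_le (A : Matrix n n ℂ) (v : EuclideanSpace ℂ n) :
    ‖Matrix.toEuclideanCLM (n := n) (𝕜 := ℂ) A v‖ ≤ ‖A‖ * ‖v‖ :=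
  ContinuousLinearMap.le_opNorm (Matrix.toEuclideanCLM (n := n) (𝕜 := ℂ) A) v

lemma inner_toEuclideanCLM_conjTranspose (A : Matrix n n ℂ) (u v : EuclideanSpace ℂ n) :
    inner ℂ u (Matrix.toEuclideanCLM (n := n) (𝕜 := ℂ) Aᴴ v) =
      inner ℂ (Matrix.toEuclideanCLM (n := n) (𝕜 := ℂ) A u) v := by
  rw [← Matrix.star_eq_conjTranspose, map_star, ContinuousLinearMap.star_eq_adjoint,
    ContinuousLinearMap.adjoint_inner_right]

/-- A completely positive map `X ↦ ∑ j, (F j)ᴴ X (F j)` has norm at most `‖∑ j, (F j)ᴴ F j‖`;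
the hypothesis bounds the quadratic form of that sum. -/
lemma norm_sum_conjTranspose_mul_mul_le (F : κ → Matrix n n ℂ) {c : ℝ} (hc : 0 ≤ c)
    (hF : ∀ v, ∑ j, ‖Matrix.toEuclideanCLM (n := n) (𝕜 := ℂ) (F j) v‖ ^ 2 ≤ c * ‖v‖ ^ 2)
    (X : Matrix n n ℂ) : ‖∑ j, (F j)ᴴ * X * F j‖ ≤ c * ‖X‖ := by
  set Φ := Matrix.toEuclideanCLM (n := n) (𝕜 := ℂ)
  change ‖Φ (∑ j, (F j)ᴴ * X * F j)‖ ≤ _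
  refine ContinuousLinearMap.opNorm_le_bound _ (by positivity) fun v => ?_
  set u := Φ (∑ j, (F j)ᴴ * X * F j) v with hu
  have hsqrt : ∀ w, √(∑ j, ‖Φ (F j) w‖ ^ 2) ≤ √c * ‖w‖ := fun w => by
    rw [← Real.sqrt_sq (norm_nonneg w), ← Real.sqrt_mul hc]
    exact Real.sqrt_le_sqrt (hF w)
  have h1 : ‖u‖ ^ 2 ≤ c * ‖X‖ * ‖v‖ * ‖u‖ := by
    calc ‖u‖ ^ 2 = ‖inner ℂ u u‖ := by rw [inner_self_eq_norm_sq_to_K]; simp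
      _ = ‖∑ j, inner ℂ (Φ (F j) u) (Φ X (Φ (F j) v))‖ := by
          congr 1
          nth_rw 2 [hu]
          rw [map_sum, sum_apply, inner_sum]
          refine Finset.sum_congr rfl fun j _ => ?_
          rw [map_mul, map_mul, mul_apply_eq_comp, mul_apply_eq_comp]
          exact inner_toEuclideanCLM_conjTranspose _ _ _
      _ ≤ ∑ j, ‖Φ (F j) u‖ * (‖X‖ * ‖Φ (F j) v‖) := by
          refine (norm_sum_le _ _).trans (Finset.sum_le_sum fun j _ => ?_)
          refine (norm_inner_le_norm _ _).trans ?_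
          gcongr
          exact norm_toEuclideanCLM_le _ _
      _ = ‖X‖ * ∑ j, ‖Φ (F j) u‖ * ‖Φ (F j) v‖ := by
          rw [Finset.mul_sum]; exact Finset.sum_congr rfl fun j _ => by ring
      _ ≤ ‖X‖ * (√c * ‖u‖ * (√c * ‖v‖)) := by
          gcongr
          refine (Real.sum_mul_le_sqrt_mul_sqrt _ _ _).trans ?_
          exact mul_le_mul (hsqrt u) (hsqrt v) (Real.sqrt_nonneg _) (by positivity)
      _ = c * ‖X‖ * ‖v‖ * ‖u‖ := by
          nth_rw 3 [← Real.mul_self_sqrt hc]; ring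
  rcases (norm_nonneg u).eq_or_lt with h0 | h0
  · rw [← h0]; positivity
  · rw [pow_two] at h1
    exact le_of_mul_le_mul_right h1 h0

/-- A density matrix pairs with `X` to a number of modulus at most `‖X‖`. -/
lemma norm_trace_mul_le_of_posSemidef {ρ : Matrix n n ℂ} (hρ : ρ.PosSemidef) (htr : ρ.trace = 1)
    (X : Matrix n n ℂ) : ‖(ρ * X).trace‖ ≤ ‖X‖ := by
  obtain ⟨C, rfl⟩ : ∃ C : Matrix n n ℂ, ρ = Cᴴ * C := by
    open scoped MatrixOrder in
    obtain ⟨C, hC⟩ := CStarAlgebra.nonneg_iff_eq_star_mul_self.mp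
      (Matrix.nonneg_iff_posSemidef.mpr hρ)
    exact ⟨C, hC⟩
  set r : n → EuclideanSpace ℂ n := fun i => WithLp.toLp 2 (fun j => star (C i j)) with hr
  have hsum : ∑ i, ‖r i‖ ^ 2 = 1 := by
    have h : ((∑ i, ‖r i‖ ^ 2 : ℝ) : ℂ) = 1 := by
      rw [← htr, Matrix.trace_mul_comm, Matrix.trace]
      push_cast
      refine Finset.sum_congr rfl fun i _ => ?_
      rw [Matrix.diag_apply, Matrix.mul_apply, ← Complex.ofReal_pow, EuclideanSpace.norm_sq_eq]
      push_cast
      refine Finset.sum_congr rfl fun j _ => ?_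
      simp [hr, Complex.mul_conj, Complex.normSq_eq_norm_sq]
    exact_mod_cast h
  have hentry : ∀ i, (C * X * Cᴴ) i i
      = inner ℂ (r i) (Matrix.toEuclideanCLM (n := n) (𝕜 := ℂ) X (r i)) := by
    intro i
    rw [EuclideanSpace.inner_eq_star_dotProduct, Matrix.ofLp_toEuclideanCLM, Matrix.mul_assoc,
      Matrix.mul_apply']
    rw [dotProduct_comm]
    congr 1
    · funext j; simp [hr]
  calc ‖(Cᴴ * C * X).trace‖ = ‖∑ i, (C * X * Cᴴ) i i‖ := by
        rw [Matrix.mul_assoc, Matrix.trace_mul_comm, Matrix.trace]; rfl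
    _ ≤ ∑ i, ‖X‖ * ‖r i‖ ^ 2 := by
        refine (norm_sum_le _ _).trans (Finset.sum_le_sum fun i _ => ?_)
        rw [hentry]
        refine (norm_inner_le_norm _ _).trans ?_
        nlinarith [norm_toEuclideanCLM_le X (r i), norm_nonneg (r i)]
    _ = ‖X‖ := by rw [← Finset.mul_sum, hsum, mul_one]

/-! ### The trace norm -/

lemma _root_.Matrix.IsHermitian.abs_eigenvalues_le_norm {A : Matrix n n ℂ} (hA : A.IsHermitian)
    (i : n) : |hA.eigenvalues i| ≤ ‖A‖ := by
  have h := Matrix.l2_opNorm_mulVec A (hA.eigenvectorBasis i)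
  rw [hA.mulVec_eigenvectorBasis i] at h
  simpa [norm_smul, WithLp.toLp_smul] using h

lemma _root_.Matrix.IsHermitian.norm_le_of_abs_eigenvalues_le {A : Matrix n n ℂ}
    (hA : A.IsHermitian) {c : ℝ} (hc : 0 ≤ c) (h : ∀ i, |hA.eigenvalues i| ≤ c) : ‖A‖ ≤ c := by
  rw [hA.spectral_theorem, Unitary.conjStarAlgAut_apply, ← Unitary.coe_star,
    CStarRing.norm_mul_coe_unitary, CStarRing.norm_coe_unitary_mul, Matrix.l2_opNorm_diagonal]
  refine (pi_norm_le_iff_of_nonneg hc).mpr fun i => ?_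
  simpa using h i

lemma traceNorm_nonneg (X : Matrix n n ℂ) : 0 ≤ traceNorm X :=
  Finset.sum_nonneg fun _ _ => Real.sqrt_nonneg _

lemma eigenvalues_conjTranspose_mul_self_nonneg (X : Matrix n n ℂ) (i : n) :
    0 ≤ (Matrix.isHermitian_conjTranspose_mul_self X).eigenvalues i :=
  (Matrix.posSemidef_conjTranspose_mul_self X).eigenvalues_nonneg i

lemma norm_le_traceNorm (X : Matrix n n ℂ) : ‖X‖ ≤ traceNorm X := by
  have h : ‖Xᴴ * X‖ ≤ traceNorm X ^ 2 := by
    refine (Matrix.isHermitian_conjTranspose_mul_self X).norm_le_of_abs_eigenvalues_le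
      (sq_nonneg _) fun i => ?_
    have h0 := eigenvalues_conjTranspose_mul_self_nonneg X i
    rw [abs_of_nonneg h0, ← Real.sq_sqrt h0]
    gcongr
    exact Finset.single_le_sum (f := fun i =>
      √((Matrix.isHermitian_conjTranspose_mul_self X).eigenvalues i))
      (fun _ _ => Real.sqrt_nonneg _) (Finset.mem_univ i)
  rw [Matrix.l2_opNorm_conjTranspose_mul_self, ← pow_two] at h
  exact (pow_le_pow_iff_left₀ (norm_nonneg _) (traceNorm_nonneg X) two_ne_zero).mp h

lemma traceNorm_le_card_mul_norm (X : Matrix n n ℂ) : traceNorm X ≤ Fintype.card n * ‖X‖ := by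
  have h : ∀ i, √((Matrix.isHermitian_conjTranspose_mul_self X).eigenvalues i) ≤ ‖X‖ := fun i => by
    refine Real.sqrt_le_iff.mpr ⟨norm_nonneg _, ?_⟩
    have := (Matrix.isHermitian_conjTranspose_mul_self X).abs_eigenvalues_le_norm i
    rw [Matrix.l2_opNorm_conjTranspose_mul_self, ← pow_two] at this
    exact (le_abs_self _).trans this
  calc traceNorm X ≤ ∑ _i : n, ‖X‖ := Finset.sum_le_sum fun i _ => h i
    _ = _ := by simp

/-- For `X = v vᴴ` the matrix `Xᴴ X` is `‖v‖²` times `X`, so that its eigenvalues are `0` and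
`‖v‖⁴`, and they sum to its trace `‖v‖⁴`. -/
lemma traceNorm_vecMulVec_star (v : n → ℂ) :
    traceNorm (Matrix.vecMulVec v (star v)) = ‖WithLp.toLp 2 v‖ ^ 2 := by
  set c : ℝ := ‖WithLp.toLp 2 v‖ ^ 2 with hc
  have hvv : star v ⬝ᵥ v = (c : ℂ) := by
    rw [dotProduct_comm, hc, EuclideanSpace.norm_sq_eq]
    simp [dotProduct, Complex.mul_conj, Complex.normSq_eq_norm_sq]
  set X := Matrix.vecMulVec v (star v) with hX
  have hXX : Xᴴ * X = (c : ℂ) • X := by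
    rw [hX, Matrix.conjTranspose_vecMulVec, star_star, Matrix.vecMulVec_mul_vecMulVec, hvv]
    simp [Matrix.vecMulVec_smul]
  have hXh : Xᴴ = X := by rw [hX, Matrix.conjTranspose_vecMulVec, star_star]
  have hX2 : X * X = (c : ℂ) • X := by rw [← hXX, hXh]
  set hY := Matrix.isHermitian_conjTranspose_mul_self X
  have hc0 : 0 ≤ c := sq_nonneg _
  have heig : ∀ i, hY.eigenvalues i = 0 ∨ hY.eigenvalues i = c ^ 2 := by
    intro i
    have h1 := hY.mulVec_eigenvectorBasis i
    set w := hY.eigenvectorBasis i with hw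
    have hYY : (Xᴴ * X) * (Xᴴ * X) = ((c ^ 2 : ℝ) : ℂ) • (Xᴴ * X) := by
      rw [hXX, smul_mul_smul_comm, hX2, smul_smul, smul_smul]
      congr 1
      push_cast
      ring
    have h2 := congrArg (fun Z => Z *ᵥ (w : n → ℂ)) hYY
    simp only [← Matrix.mulVec_mulVec, Matrix.smul_mulVec, h1, Matrix.mulVec_smul] at h2
    have hw0 : (w : n → ℂ) ≠ 0 := fun h => by
      have h3 : ‖w‖ = 1 := hY.eigenvectorBasis.orthonormal.1 i
      have : w = 0 := by ext j; exact congrFun h j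
      rw [this, norm_zero] at h3
      exact zero_ne_one h3
    rw [Complex.coe_smul, smul_smul, smul_smul] at h2
    have h3 := smul_left_injective ℝ hw0 h2
    rcases eq_or_ne (hY.eigenvalues i) 0 with h | h
    · exact Or.inl h
    · exact Or.inr (mul_right_cancel₀ h h3)
  have htr : ∑ i, hY.eigenvalues i = c ^ 2 := by
    have h1 := hY.trace_eq_sum_eigenvalues
    have h3 : (Xᴴ * X).trace = ((c ^ 2 : ℝ) : ℂ) := by
      rw [hXX, Matrix.trace_smul, hX, Matrix.trace_vecMulVec, dotProduct_comm, hvv, smul_eq_mul]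
      push_cast
      ring
    have h2 : ((∑ i, hY.eigenvalues i : ℝ) : ℂ) = ((c ^ 2 : ℝ) : ℂ) := by
      rw [← h3, h1]; simp
    exact_mod_cast h2
  rcases hc0.eq_or_lt with h0 | h0
  · have : ∀ i, hY.eigenvalues i = 0 := fun i => by
      simpa [← h0] using heig i
    simp [traceNorm, ← h0, this]
  · have hs : ∀ i, c * √(hY.eigenvalues i) = hY.eigenvalues i := fun i => by
      rcases heig i with h | h
      · simp [h]
      · rw [h, Real.sqrt_sq hc0, pow_two]
    have : c * traceNorm X = c * c := by
      rw [traceNorm, Finset.mul_sum, ← pow_two, ← htr]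
      exact Finset.sum_congr rfl fun i _ => hs i
    exact mul_left_cancel₀ h0.ne' this

end Matrices

/-! ### The Lindblad generator in the Heisenberg picture -/

section Generator

variable {n ι : Type*} [Fintype n] [DecidableEq n] [Fintype ι]

lemma norm_sandwich_le (A B : Matrix n n ℂ) : ‖sandwich A B‖ ≤ ‖A‖ * ‖B‖ :=
  ContinuousLinearMap.opNorm_mulLeftRight_apply_apply_le ℂ (Matrix n n ℂ) A B

lemma conjTranspose_effective {n ι : Type*} [Fintype n] [Fintype ι]
    {H : Matrix n n ℂ} (hH : H.IsHermitian) (L : ι → Matrix n n ℂ) :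
    (effective H L)ᴴ = Complex.I • H - (1 / 2 : ℂ) • ∑ j, (L j)ᴴ * L j := by
  simp [effective, Matrix.conjTranspose_sub, Matrix.conjTranspose_smul, hH.eq,
    Matrix.conjTranspose_sum, Matrix.conjTranspose_mul]

lemma sum_conjTranspose_mul_self_eq {n ι : Type*} [Fintype n] [Fintype ι]
    {H : Matrix n n ℂ} (hH : H.IsHermitian) (L : ι → Matrix n n ℂ) :
    ∑ j, (L j)ᴴ * L j = -(effective H L + (effective H L)ᴴ) := by
  rw [conjTranspose_effective hH, effective, neg_smul]
  have : ∀ Z : Matrix n n ℂ, Z = (1 / 2 : ℂ) • Z + (1 / 2 : ℂ) • Z := fun Z => by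
    rw [← add_smul]; norm_num
  nth_rw 1 [this (∑ j, (L j)ᴴ * L j)]
  abel

lemma lindbladian_apply {H : Matrix n n ℂ} (hH : H.IsHermitian) (L : ι → Matrix n n ℂ)
    (X : Matrix n n ℂ) :
    lindbladian H L X
      = effective H L * X + X * (effective H L)ᴴ + ∑ j, L j * X * (L j)ᴴ := by
  rw [conjTranspose_effective hH]
  simp only [lindbladian, effective, add_apply, smul_apply, sub_apply,
    FunLike.coe_sum, Finset.sum_apply, sandwich_apply, one_mul,
    mul_one, sub_mul, mul_sub, Finset.sum_sub_distrib, smul_mul_assoc, mul_smul_comm,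
    Finset.sum_mul, Finset.mul_sum, smul_sub, smul_add, Finset.sum_add_distrib,
    Finset.smul_sum]
  simp only [neg_smul]
  abel

/-- The Lindblad generator in the Heisenberg picture, `Y ↦ Aᴴ Y + Y A + ∑ j, (L j)ᴴ Y (L j)`. -/
def dualLindbladian (H : Matrix n n ℂ) (L : ι → Matrix n n ℂ) : SuperOp n :=
  sandwich (effective H L)ᴴ 1 + sandwich 1 (effective H L) + ∑ j, sandwich (L j)ᴴ (L j)

/-- The second-order coefficient of the scheme in the Heisenberg picture, `Y ↦ Aᴴ Y A`. -/
def dualSecondOrder (H : Matrix n n ℂ) (L : ι → Matrix n n ℂ) : SuperOp n :=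
  sandwich (effective H L)ᴴ (effective H L)

lemma norm_dualSecondOrder_le (H : Matrix n n ℂ) (L : ι → Matrix n n ℂ) :
    ‖dualSecondOrder H L‖ ≤ ‖effective H L‖ ^ 2 := by
  refine (norm_sandwich_le _ _).trans ?_
  rw [Matrix.l2_opNorm_conjTranspose, pow_two]

lemma norm_secondOrder_le (H : Matrix n n ℂ) (L : ι → Matrix n n ℂ) :
    ‖secondOrder H L‖ ≤ ‖effective H L‖ ^ 2 := by
  refine (norm_sandwich_le _ _).trans ?_
  rw [Matrix.l2_opNorm_conjTranspose, pow_two]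

/-- Trace preservation of the generator, as an identity of quadratic forms. -/
lemma sum_norm_sq_jump {H : Matrix n n ℂ} (hH : H.IsHermitian) (L : ι → Matrix n n ℂ)
    (v : EuclideanSpace ℂ n) :
    ∑ j, ‖Matrix.toEuclideanCLM (n := n) (𝕜 := ℂ) (L j) v‖ ^ 2 =
      -(2 * (inner ℂ v (Matrix.toEuclideanCLM (n := n) (𝕜 := ℂ) (effective H L) v)).re) := by
  set Φ := Matrix.toEuclideanCLM (n := n) (𝕜 := ℂ)
  have h1 : inner ℂ v (Φ (∑ j, (L j)ᴴ * L j) v) = ((∑ j, ‖Φ (L j) v‖ ^ 2 : ℝ) : ℂ) := by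
    rw [map_sum, sum_apply, inner_sum]
    push_cast
    refine Finset.sum_congr rfl fun j _ => ?_
    rw [map_mul, mul_apply_eq_comp, inner_toEuclideanCLM_conjTranspose, inner_self_eq_norm_sq_to_K]
    rfl
  rw [sum_conjTranspose_mul_self_eq hH L] at h1
  have h2 := congrArg Complex.re h1
  rw [Complex.ofReal_re] at h2
  rw [← h2, map_neg, map_add, neg_apply, add_apply, inner_neg_right,
    inner_add_right, inner_toEuclideanCLM_conjTranspose, Complex.neg_re, Complex.add_re,
    ← inner_conj_symm (Φ (effective H L) v) v, Complex.conj_re]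
  ring

lemma norm_dualLindbladian_le {H : Matrix n n ℂ} (hH : H.IsHermitian) (L : ι → Matrix n n ℂ) :
    ‖dualLindbladian H L‖ ≤ 4 * ‖effective H L‖ := by
  refine ContinuousLinearMap.opNorm_le_bound _ (by positivity) fun X => ?_
  have hj : ‖∑ j, (L j)ᴴ * X * L j‖ ≤ (2 * ‖effective H L‖) * ‖X‖ := by
    refine norm_sum_conjTranspose_mul_mul_le L (by positivity) (fun v => ?_) X
    rw [sum_norm_sq_jump hH]
    set w := Matrix.toEuclideanCLM (n := n) (𝕜 := ℂ) (effective H L) v with hw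
    have h1 : |(inner ℂ v w).re| ≤ ‖v‖ * ‖w‖ :=
      (Complex.abs_re_le_norm _).trans (norm_inner_le_norm _ _)
    have h2 : ‖w‖ ≤ ‖effective H L‖ * ‖v‖ := norm_toEuclideanCLM_le _ _
    have h3 := mul_le_mul_of_nonneg_left h2 (norm_nonneg v)
    have h4 := neg_abs_le (inner ℂ v w).re
    nlinarith
  have h1 : ‖(effective H L)ᴴ * X‖ ≤ ‖effective H L‖ * ‖X‖ := by
    simpa only [Matrix.l2_opNorm_conjTranspose] using Matrix.l2_opNorm_mul (effective H L)ᴴ X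
  have h2 : ‖X * effective H L‖ ≤ ‖X‖ * ‖effective H L‖ := Matrix.l2_opNorm_mul _ _
  simp only [dualLindbladian, add_apply, FunLike.coe_sum, Finset.sum_apply, sandwich_apply,
    mul_one, one_mul]
  have h3 := norm_add₃_le (a := (effective H L)ᴴ * X) (b := X * effective H L)
    (c := ∑ j, (L j)ᴴ * X * L j)
  linarith

/-- Up to second order in `h`, the map `1 + h G` is the Heisenberg dual of a Kraus step, and that
dual is a contraction up to `h² Aᴴ A`. -/
lemma norm_one_add_smul_dualLindbladian_le {H : Matrix n n ℂ} (hH : H.IsHermitian)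
    (L : ι → Matrix n n ℂ) {h : ℝ} (hh : 0 ≤ h) :
    ‖1 + (h : ℂ) • dualLindbladian H L‖ ≤ 1 + 2 * ‖effective H L‖ ^ 2 * h ^ 2 := by
  set A := effective H L with hA
  set Φ := Matrix.toEuclideanCLM (n := n) (𝕜 := ℂ)
  set F : Option ι → Matrix n n ℂ := fun o => o.elim (krausZero H L h) (krausJump L h) with hF
  have hs : ((√h : ℝ) : ℂ) * ((√h : ℝ) : ℂ) = h := by
    rw [← Complex.ofReal_mul, Real.mul_self_sqrt hh]
  refine ContinuousLinearMap.opNorm_le_bound _ (by positivity) fun X => ?_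
  have hK : ‖∑ o, (F o)ᴴ * X * F o‖ ≤ (1 + h ^ 2 * ‖A‖ ^ 2) * ‖X‖ := by
    refine norm_sum_conjTranspose_mul_mul_le F (by positivity) (fun v => ?_) X
    have h0 : ‖Φ (krausZero H L h) v‖ ^ 2
        = ‖v‖ ^ 2 + 2 * h * (inner ℂ v (Φ A v)).re + h ^ 2 * ‖Φ A v‖ ^ 2 := by
      rw [krausZero, map_add, map_one, map_smul, add_apply, smul_apply,
        one_apply_eq_self, norm_add_sq (𝕜 := ℂ), inner_smul_right, norm_smul,
        Complex.norm_real, mul_pow, Real.norm_eq_abs, sq_abs]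
      simp
      ring
    have hj : ∀ j, ‖Φ (krausJump L h j) v‖ ^ 2 = h * ‖Φ (L j) v‖ ^ 2 := fun j => by
      rw [krausJump, map_smul, smul_apply, norm_smul, Complex.norm_real, mul_pow,
        Real.norm_eq_abs, sq_abs, Real.sq_sqrt hh]
    rw [Fintype.sum_option]
    simp only [hF, Option.elim]
    rw [h0, Finset.sum_congr rfl fun j _ => hj j, ← Finset.mul_sum, sum_norm_sq_jump hH]
    have h2 : ‖Φ A v‖ ^ 2 ≤ (‖A‖ * ‖v‖) ^ 2 := by
      gcongr; exact norm_toEuclideanCLM_le _ _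
    rw [mul_pow] at h2
    nlinarith [mul_le_mul_of_nonneg_left h2 (sq_nonneg h)]
  have hEq : (1 + (h : ℂ) • dualLindbladian H L) X
      = (∑ o, (F o)ᴴ * X * F o) - ((h : ℂ) ^ 2) • (Aᴴ * X * A) := by
    have hj : ∀ j, (krausJump L h j)ᴴ * X * krausJump L h j = (h : ℂ) • ((L j)ᴴ * X * L j) := by
      intro j
      simp only [krausJump, Matrix.conjTranspose_smul, Complex.star_def, Complex.conj_ofReal,
        smul_mul_assoc, mul_smul_comm, smul_smul, hs]
    rw [Fintype.sum_option]
    simp only [hF, Option.elim, hj, krausZero, Matrix.conjTranspose_add, Matrix.conjTranspose_one,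
      Matrix.conjTranspose_smul, Complex.star_def, Complex.conj_ofReal, add_mul, mul_add, one_mul,
      mul_one, smul_mul_assoc, mul_smul_comm, smul_smul, ← Finset.smul_sum, dualLindbladian,
      add_apply, smul_apply, one_apply_eq_self, FunLike.coe_sum, Finset.sum_apply, sandwich_apply,
      smul_add, pow_two, ← hA]
    abel
  have hM : ‖((h : ℂ) ^ 2) • (Aᴴ * X * A)‖ ≤ h ^ 2 * (‖A‖ ^ 2 * ‖X‖) := by
    rw [norm_smul, norm_pow, Complex.norm_real, Real.norm_eq_abs, sq_abs]
    gcongr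
    calc ‖Aᴴ * X * A‖ ≤ ‖Aᴴ‖ * ‖X‖ * ‖A‖ := norm_mul₃_le
      _ = _ := by rw [Matrix.l2_opNorm_conjTranspose]; ring
  rw [hEq]
  refine (norm_sub_le _ _).trans ((add_le_add hK hM).trans (le_of_eq ?_))
  ring

lemma lindbladBound_nonneg (H : Matrix n n ℂ) (L : ι → Matrix n n ℂ) : 0 ≤ lindbladBound H L := by
  unfold lindbladBound; positivity

lemma norm_effective_add_le (H : Matrix n n ℂ) (L : ι → Matrix n n ℂ) :
    ‖effective H L‖ ≤ ‖H‖ + 1 / 2 * ∑ j, ‖L j‖ ^ 2 := by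
  refine (norm_sub_le _ _).trans (add_le_add ?_ ?_)
  · simp [norm_smul]
  · rw [norm_smul]
    gcongr
    · simp
    · refine norm_sum_le_of_le _ fun j _ => ?_
      rw [Matrix.l2_opNorm_conjTranspose_mul_self, pow_two]

lemma norm_effective_le (H : Matrix n n ℂ) (L : ι → Matrix n n ℂ) :
    ‖effective H L‖ ≤ lindbladBound H L / 2 := by
  have h := norm_effective_add_le H L
  have h2 : 0 ≤ ∑ j, ‖L j‖ ^ 2 := by positivity
  unfold lindbladBound
  linarith

lemma norm_lindbladian_le {H : Matrix n n ℂ} (hH : H.IsHermitian) (L : ι → Matrix n n ℂ) :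
    ‖lindbladian H L‖ ≤ lindbladBound H L := by
  refine ContinuousLinearMap.opNorm_le_bound _ (lindbladBound_nonneg H L) fun X => ?_
  rw [lindbladian_apply hH]
  have h1 : ‖effective H L * X‖ ≤ ‖effective H L‖ * ‖X‖ := Matrix.l2_opNorm_mul _ _
  have h2 : ‖X * (effective H L)ᴴ‖ ≤ ‖X‖ * ‖effective H L‖ := by
    simpa only [Matrix.l2_opNorm_conjTranspose] using Matrix.l2_opNorm_mul X (effective H L)ᴴ
  have h3 : ‖∑ j, L j * X * (L j)ᴴ‖ ≤ (∑ j, ‖L j‖ ^ 2) * ‖X‖ := by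
    rw [Finset.sum_mul]
    refine norm_sum_le_of_le _ fun j _ => ?_
    calc ‖L j * X * (L j)ᴴ‖ ≤ ‖L j‖ * ‖X‖ * ‖(L j)ᴴ‖ := norm_mul₃_le
      _ = _ := by rw [Matrix.l2_opNorm_conjTranspose]; ring
  have h4 := norm_add₃_le (a := effective H L * X) (b := X * (effective H L)ᴴ)
    (c := ∑ j, L j * X * (L j)ᴴ)
  have h5 := mul_le_mul_of_nonneg_right (norm_effective_add_le H L) (norm_nonneg X)
  unfold lindbladBound
  nlinarith

/-- Rank-one projections show that `‖ℳ₂‖ ≥ ‖A‖²`; the crude comparison of the trace norm with the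
operator norm is only needed for the supremum defining `superNorm` to be over a bounded set. -/
lemma norm_effective_sq_le_superNorm (H : Matrix n n ℂ) (L : ι → Matrix n n ℂ) :
    ‖effective H L‖ ^ 2 ≤ superNorm (secondOrder H L) := by
  set A := effective H L with hA
  have hbdd : BddAbove {r : ℝ | ∃ X : Matrix n n ℂ, X.IsHermitian ∧ traceNorm X ≤ 1 ∧
      r = traceNorm (secondOrder H L X)} := by
    refine ⟨Fintype.card n * (‖secondOrder H L‖ * 1), ?_⟩
    rintro r ⟨X, -, hX, rfl⟩
    refine (traceNorm_le_card_mul_norm _).trans ?_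
    gcongr
    exact ((secondOrder H L).le_opNorm X).trans
      (mul_le_mul_of_nonneg_left ((norm_le_traceNorm X).trans hX) (norm_nonneg _))
  have hunit : ∀ v : EuclideanSpace ℂ n, ‖v‖ = 1 →
      ‖Matrix.toEuclideanCLM (n := n) (𝕜 := ℂ) A v‖ ^ 2 ≤ superNorm (secondOrder H L) := by
    intro v hv
    refine le_csSup hbdd ⟨Matrix.vecMulVec v (star (v : n → ℂ)), ?_, ?_, ?_⟩
    · rw [Matrix.IsHermitian, Matrix.conjTranspose_vecMulVec, star_star]
    · rw [traceNorm_vecMulVec_star]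
      change ‖v‖ ^ 2 ≤ 1
      rw [hv, one_pow]
    · have : secondOrder H L (Matrix.vecMulVec v (star (v : n → ℂ)))
          = Matrix.vecMulVec (A *ᵥ v) (star (A *ᵥ v)) := by
        rw [secondOrder, sandwich_apply, Matrix.mul_vecMulVec, Matrix.vecMulVec_mul,
          Matrix.star_mulVec]
      rw [this, traceNorm_vecMulVec_star]
      rfl
  have hB : 0 ≤ superNorm (secondOrder H L) := by
    refine Real.sSup_nonneg ?_
    rintro r ⟨X, -, -, rfl⟩
    exact traceNorm_nonneg _
  have hle : ‖A‖ ≤ √(superNorm (secondOrder H L)) := by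
    change ‖Matrix.toEuclideanCLM (n := n) (𝕜 := ℂ) A‖ ≤ _
    refine ContinuousLinearMap.opNorm_le_of_unit_norm (𝕜 := ℂ) (Real.sqrt_nonneg _) fun v hv => ?_
    exact Real.le_sqrt_of_sq_le (hunit v hv)
  calc ‖A‖ ^ 2 ≤ √(superNorm (secondOrder H L)) ^ 2 := by gcongr
    _ = _ := Real.sq_sqrt hB

lemma isHermitian_scaledH {n : Type*} {H : Matrix n n ℂ} (hH : H.IsHermitian) (T : ℝ) :
    (scaledH H T).IsHermitian := by
  rw [scaledH, Matrix.IsHermitian, Matrix.conjTranspose_smul, hH.eq, Complex.star_def,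
    Complex.conj_ofReal]

lemma effective_scaled (H : Matrix n n ℂ) (L : ι → Matrix n n ℂ) {T : ℝ} (hT : 0 ≤ T) :
    effective (scaledH H T) (scaledL L T) = (T : ℂ) • effective H L := by
  have hs : ((√T : ℝ) : ℂ) * ((√T : ℝ) : ℂ) = T := by
    rw [← Complex.ofReal_mul, Real.mul_self_sqrt hT]
  simp only [effective, scaledH, scaledL, Matrix.conjTranspose_smul, Complex.star_def,
    Complex.conj_ofReal, smul_mul_smul_comm, hs, ← Finset.smul_sum, smul_sub]
  rw [smul_comm (T : ℂ), smul_comm (T : ℂ)]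

lemma lindbladBound_scaled (H : Matrix n n ℂ) (L : ι → Matrix n n ℂ) {T : ℝ} (hT : 0 ≤ T) :
    lindbladBound (scaledH H T) (scaledL L T) = T * lindbladBound H L := by
  simp only [lindbladBound, scaledH, scaledL, norm_smul, Complex.norm_real, Real.norm_eq_abs,
    abs_of_nonneg hT, mul_pow, sq_abs, Real.sq_sqrt hT, ← Finset.mul_sum]
  ring

end Generator

/-! ### Duality for the trace pairing -/

section Duality

variable {n ι : Type*} [Fintype n] [DecidableEq n] [Fintype ι]

/-- `S'` is the dual of the superoperator `S` for the trace pairing `Tr (X Y)`. -/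
def IsTraceDual (S S' : SuperOp n) : Prop :=
  ∀ X Y : Matrix n n ℂ, (S X * Y).trace = (X * S' Y).trace

namespace IsTraceDual

variable {S S' R R' : SuperOp n}

lemma one : IsTraceDual (1 : SuperOp n) 1 := fun _ _ => rfl

lemma sandwich (A B : Matrix n n ℂ) : IsTraceDual (sandwich A B) (sandwich B A) := fun X Y => by
  rw [sandwich_apply, sandwich_apply, Matrix.mul_assoc, Matrix.mul_assoc, Matrix.trace_mul_comm,
    Matrix.mul_assoc, Matrix.mul_assoc]

lemma add (hS : IsTraceDual S S') (hR : IsTraceDual R R') : IsTraceDual (S + R) (S' + R') :=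
  fun X Y => by
    rw [add_apply, add_apply, add_mul, mul_add, Matrix.trace_add, Matrix.trace_add, hS, hR]

lemma smul (hS : IsTraceDual S S') (c : ℂ) : IsTraceDual (c • S) (c • S') := fun X Y => by
  rw [smul_apply, smul_apply, smul_mul_assoc, mul_smul_comm, Matrix.trace_smul,
    Matrix.trace_smul, hS]

lemma sum {F F' : ι → SuperOp n} (h : ∀ j, IsTraceDual (F j) (F' j)) :
    IsTraceDual (∑ j, F j) (∑ j, F' j) := fun X Y => by
  rw [sum_apply, sum_apply, Finset.sum_mul, Finset.mul_sum, Matrix.trace_sum, Matrix.trace_sum]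
  exact Finset.sum_congr rfl fun j _ => h j X Y

lemma pow (hS : IsTraceDual S S') (k : ℕ) : IsTraceDual (S ^ k) (S' ^ k) := by
  induction k with
  | zero => simpa using one
  | succ k ih =>
    intro X Y
    rw [pow_succ, pow_succ', mul_apply_eq_comp, mul_apply_eq_comp, ih, hS]

lemma hasSum {F F' : ℕ → SuperOp n} (h : ∀ j, IsTraceDual (F j) (F' j)) (hF : HasSum F S)
    (hF' : HasSum F' S') : IsTraceDual S S' := fun X Y => by
  have h1 : Continuous fun Z : SuperOp n => (Z X * Y).trace := by fun_prop
  have h2 : Continuous fun Z : SuperOp n => (X * Z Y).trace := by fun_prop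
  let f₁ : SuperOp n →+ ℂ :=
    { toFun := fun Z => (Z X * Y).trace
      map_zero' := by simp
      map_add' := fun P Q => by rw [add_apply, add_mul, Matrix.trace_add] }
  let f₂ : SuperOp n →+ ℂ :=
    { toFun := fun Z => (X * Z Y).trace
      map_zero' := by simp
      map_add' := fun P Q => by rw [add_apply, mul_add, Matrix.trace_add] }
  have e1 : HasSum (fun j => (F j X * Y).trace) (S X * Y).trace := hF.map f₁ h1
  have e2 : HasSum (fun j => (X * F' j Y).trace) (X * S' Y).trace := hF'.map f₂ h2
  simp only [h _ X Y] at e1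
  exact e1.unique e2

lemma exp (hS : IsTraceDual S S') : IsTraceDual (NormedSpace.exp S) (NormedSpace.exp S') :=
  hasSum (fun k => (hS.pow k).smul _) (NormedSpace.exp_series_hasSum_exp' (𝕂 := ℂ) S)
    (NormedSpace.exp_series_hasSum_exp' (𝕂 := ℂ) S')

end IsTraceDual

lemma isTraceDual_lindbladian {H : Matrix n n ℂ} (hH : H.IsHermitian) (L : ι → Matrix n n ℂ) :
    IsTraceDual (lindbladian H L) (dualLindbladian H L) := by
  have : lindbladian H L = sandwich (effective H L) 1 + sandwich 1 (effective H L)ᴴ +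
      ∑ j, sandwich (L j) (L j)ᴴ := by
    ext1 X
    simp [lindbladian_apply hH]
  rw [this, dualLindbladian, add_comm (sandwich (effective H L)ᴴ 1)]
  exact ((IsTraceDual.sandwich _ _).add (IsTraceDual.sandwich _ _)).add
    (IsTraceDual.sum fun j => IsTraceDual.sandwich _ _)

lemma isTraceDual_secondOrder (H : Matrix n n ℂ) (L : ι → Matrix n n ℂ) :
    IsTraceDual (secondOrder H L) (dualSecondOrder H L) := IsTraceDual.sandwich _ _

end Duality

/-! ### Cauchy estimates on an interval -/

section Gevrey

lemma iteratedDerivWithin_Icc_eq_iteratedDeriv {f : ℝ → ℂ} {g : ℂ → ℂ} {R r : ℝ} (hR : 0 < R)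
    (hRr : R < r) (hg : DifferentiableOn ℂ g (Metric.ball 0 r))
    (hfg : ∀ τ ∈ Set.Icc 0 R, f τ = g τ) (k : ℕ) :
    (∀ τ ∈ Set.Icc 0 R, iteratedDerivWithin k f (Set.Icc 0 R) τ = iteratedDeriv k g τ) ∧
      ∀ τ ∈ Set.Icc 0 R,
        HasDerivWithinAt (iteratedDerivWithin k f (Set.Icc 0 R)) (iteratedDeriv (k + 1) g τ)
          (Set.Icc 0 R) τ := by
  have hmem : ∀ τ ∈ Set.Icc 0 R, (τ : ℂ) ∈ Metric.ball (0 : ℂ) r := fun τ hτ => by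
    rw [mem_ball_zero_iff, Complex.norm_real, Real.norm_eq_abs, abs_of_nonneg hτ.1]
    exact hτ.2.trans_lt hRr
  have han : ∀ k, AnalyticOnNhd ℂ (iteratedDeriv k g) (Metric.ball 0 r) := fun k => by
    rw [iteratedDeriv_eq_iterate]
    exact (hg.analyticOnNhd Metric.isOpen_ball).iterated_deriv k
  have hstep : ∀ k,
      (∀ τ ∈ Set.Icc 0 R, iteratedDerivWithin k f (Set.Icc 0 R) τ = iteratedDeriv k g τ) →
      ∀ τ ∈ Set.Icc 0 R,
        HasDerivWithinAt (iteratedDerivWithin k f (Set.Icc 0 R)) (iteratedDeriv (k + 1) g τ)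
          (Set.Icc 0 R) τ := by
    intro k hk τ hτ
    have h1 : HasDerivAt (iteratedDeriv k g) (iteratedDeriv (k + 1) g τ) τ := by
      rw [iteratedDeriv_succ]
      exact (han k _ (hmem τ hτ)).differentiableAt.hasDerivAt
    exact (h1.comp_ofReal.hasDerivWithinAt).congr hk (hk τ hτ)
  have hmain : ∀ k, ∀ τ ∈ Set.Icc 0 R,
      iteratedDerivWithin k f (Set.Icc 0 R) τ = iteratedDeriv k g τ := by
    intro k
    induction k with
    | zero => intro τ hτ; simpa using hfg τ hτ
    | succ k ih =>
      intro τ hτ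
      rw [iteratedDerivWithin_succ]
      exact (hstep k ih τ hτ).derivWithin (uniqueDiffOn_Icc hR τ hτ)
  exact ⟨hmain k, hstep k (hmain k)⟩

/-- Cauchy's estimates on circles of radius `1 / ν` centred at the points of `[0, R]`. These circles
lie in the disc of radius `3 / (2 ν)` around `0`. -/
lemma gevrey_of_differentiableOn {f : ℝ → ℂ} {g : ℂ → ℂ} {R ν C : ℝ} (hR : 0 < R) (hν : 0 < ν)
    (hRν : R ≤ 1 / (2 * ν)) (hg : DifferentiableOn ℂ g (Metric.ball 0 (2 / ν)))
    (hC : ∀ z : ℂ, ‖z‖ ≤ 3 / 2 / ν → ‖g z‖ ≤ C) (hfg : ∀ τ ∈ Set.Icc 0 R, f τ = g τ) :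
    IsGevreyOn 1 f R ∧ GevreyBound f C ν R := by
  have h2 : R ≤ 1 / 2 / ν := by rwa [div_div]
  have hRr : R < 2 / ν := h2.trans_lt (by gcongr; norm_num)
  have hit := fun k => iteratedDerivWithin_Icc_eq_iteratedDeriv hR hRr hg hfg k
  have hbound : ∀ k : ℕ, ∀ τ ∈ Set.Icc 0 R,
      ‖iteratedDerivWithin k f (Set.Icc 0 R) τ‖ ≤ C * ν ^ k * (k ! : ℝ) := by
    intro k τ hτ
    rw [(hit k).1 τ hτ]
    have hball : ∀ z ∈ Metric.closedBall (τ : ℂ) (1 / ν), ‖z‖ ≤ 3 / 2 / ν := by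
      intro z hz
      have h3 : ‖z‖ ≤ ‖z - τ‖ + ‖(τ : ℂ)‖ := by simpa using norm_add_le (z - τ) (τ : ℂ)
      have h4 : ‖(τ : ℂ)‖ ≤ 1 / 2 / ν := by
        rw [Complex.norm_real, Real.norm_eq_abs, abs_of_nonneg hτ.1]; exact hτ.2.trans h2
      have h5 : ‖z - τ‖ ≤ 1 / ν := by simpa [dist_eq_norm] using hz
      have h6 : 3 / 2 / ν = 1 / ν + 1 / 2 / ν := by ring
      linarith
    have hdc : DiffContOnCl ℂ g (Metric.ball (τ : ℂ) (1 / ν)) := by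
      apply DifferentiableOn.diffContOnCl
      refine hg.mono fun z hz => ?_
      rw [mem_ball_zero_iff]
      refine (hball z (Metric.closure_ball_subset_closedBall hz)).trans_lt ?_
      gcongr
      norm_num
    have := Complex.norm_iteratedDeriv_le_of_forall_mem_sphere_norm_le k
      (show 0 < 1 / ν by positivity) hdc
      (fun z hz => hC z (hball z (Metric.sphere_subset_closedBall hz)))
    refine this.trans (le_of_eq ?_)
    rw [div_pow, one_pow]
    field_simp
  refine ⟨⟨?_, C, ν, fun k τ hτ => ?_⟩, fun k _ => hbound k⟩
  · refine contDiffOn_of_differentiableOn_deriv fun m _ τ hτ => ?_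
    exact ((hit m).2 τ hτ).differentiableWithinAt
  · rw [Real.rpow_one]; exact hbound k τ hτ

end Gevrey

/-! ### The scheme for complex step sizes -/

section Scheme

variable {n ι : Type*} [Fintype n] [DecidableEq n] [Fintype ι]

lemma norm_dualLindbladian_add_smul_le {H : Matrix n n ℂ} (hH : H.IsHermitian)
    (L : ι → Matrix n n ℂ) {z : ℂ} {q : ℝ} (hz : ‖z‖ ≤ q) :
    ‖dualLindbladian H L + z • dualSecondOrder H L‖
      ≤ ‖effective H L‖ * (4 + q * ‖effective H L‖) := by
  refine (norm_add_le _ _).trans ?_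
  rw [norm_smul]
  have h1 := norm_dualLindbladian_le hH L
  have h2 := mul_le_mul hz (norm_dualSecondOrder_le H L) (norm_nonneg _)
    ((norm_nonneg _).trans hz)
  linarith

/-- The perturbation `T (z⁻¹ log (1 + z G + z² M) - G)` of `T G` has norm at most
`1 + log 2`, and `T G` generates a contraction semigroup. -/
lemma norm_exp_smul_logQuotient_le {H : Matrix n n ℂ} (hH : H.IsHermitian) (L : ι → Matrix n n ℂ)
    {T ν : ℝ} (hT : 0 ≤ T) (hν : 0 < ν) (hTA : T * ‖effective H L‖ ^ 2 ≤ 0.106 * ν)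
    (hA : ‖effective H L‖ ≤ 0.0143 * ν) {z : ℂ} (hz : ‖z‖ ≤ 3 / 2 / ν) :
    ‖NormedSpace.exp ((T : ℂ) • logQuotient (dualLindbladian H L) (dualSecondOrder H L) z)‖
      ≤ 2 * Real.exp 1 := by
  set a := ‖effective H L‖ with ha
  set G := dualLindbladian H L
  set M := dualSecondOrder H L
  set q := 3 / 2 / ν with hq
  have hqν : q * ν = 3 / 2 := by rw [hq]; field_simp
  have hq0 : 0 < q := by positivity
  have ha0 : 0 ≤ a := norm_nonneg _
  set p := q * a with hp
  have hp0 : 0 ≤ p := by positivity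
  have hp1 : p ≤ 0.02145 := by
    have := mul_le_mul_of_nonneg_left hA hq0.le
    rw [hp]; linarith
  set P := T * (q * a ^ 2) with hP
  have hP0 : 0 ≤ P := by positivity
  have hP1 : P ≤ 0.159 := by
    have := mul_le_mul_of_nonneg_left hTA hq0.le
    rw [hP]; linarith
  have hqs : q * (a * (4 + q * a)) = p * (4 + p) := by rw [hp]; ring
  have hpp : p * (4 + p) ≤ 0.0863 := by nlinarith
  have hE := norm_logQuotient_sub_le (𝔸 := SuperOp n) hz (by rw [hqs]; linarith)
    (norm_dualLindbladian_add_smul_le hH L hz) (norm_dualSecondOrder_le H L)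
  rw [← ha] at hE
  set δ := q * a ^ 2 + q * (a * (4 + q * a)) ^ 2 / 2 / (1 - q * (a * (4 + q * a))) with hδ
  -- Any bound below `1 + log 2 ≈ 1.69` would do.
  have hTδ : T * δ ≤ 1.6 := by
    have h1 : T * δ = P + P * (4 + p) ^ 2 / 2 / (1 - p * (4 + p)) := by
      rw [hδ, hqs, hP, hp]; ring
    have h2 : P * (4 + p) ^ 2 / 2 / (1 - p * (4 + p)) ≤ 1.44 := by
      rw [div_le_iff₀ (by linarith)]
      have h3 : (4 + p) ^ 2 ≤ 16.18 := by nlinarith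
      have h4 : P * (4 + p) ^ 2 ≤ 0.159 * 16.18 := mul_le_mul hP1 h3 (sq_nonneg _) (by norm_num)
      linarith
    linarith
  have hexp : Real.exp (T * δ) ≤ 2 * Real.exp 1 := by
    calc Real.exp (T * δ) ≤ Real.exp (Real.log 2 + 1) := by
          apply Real.exp_le_exp.mpr
          linarith [Real.log_two_gt_d9]
      _ = 2 * Real.exp 1 := by rw [Real.exp_add, Real.exp_log two_pos]
  refine le_trans (norm_exp_le_of_norm_one_add_smul_le (𝔸 := SuperOp n) (c := 2 * a ^ 2 * T ^ 2)
    fun h hh => ?_) hexp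
  have hsplit : 1 + (h : ℂ) • ((T : ℂ) • logQuotient G M z)
      = (1 + ((h * T : ℝ) : ℂ) • G) + ((h * T : ℝ) : ℂ) • (logQuotient G M z - G) := by
    rw [smul_sub, smul_smul, Complex.ofReal_mul]; abel
  rw [hsplit]
  refine (norm_add_le _ _).trans ?_
  rw [norm_smul, Complex.norm_real, Real.norm_eq_abs, abs_of_nonneg (by positivity : 0 ≤ h * T)]
  have h1 := norm_one_add_smul_dualLindbladian_le hH L (by positivity : 0 ≤ h * T)
  have h2 := mul_le_mul_of_nonneg_left hE (by positivity : 0 ≤ h * T)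
  rw [← ha] at h1
  linarith

/-- Pairing with `O` and passing to the Heisenberg picture turns `f(τ)` into a function which makes
sense for complex `τ` near `0`. -/
lemma observable_eq {H : Matrix n n ℂ} (hH : H.IsHermitian) (L : ι → Matrix n n ℂ)
    (ρ₀ O : Matrix n n ℂ) (T : ℝ) {τ : ℝ} (hτ : 0 ≤ τ)
    (hK : ‖krausStep H L τ - 1‖ < 1)
    (hK' : ‖(τ : ℂ) • dualLindbladian H L + (τ : ℂ) ^ 2 • dualSecondOrder H L‖ < 1) :
    observable H L ρ₀ O T τ = (ρ₀ * NormedSpace.exp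
      ((T : ℂ) • logQuotient (dualLindbladian H L) (dualSecondOrder H L) τ) O).trace := by
  rcases hτ.eq_or_lt with rfl | hτ'
  · rw [observable, rhoApprox, if_pos rfl, Complex.ofReal_zero, logQuotient_zero (𝔸 := SuperOp n)]
    exact ((isTraceDual_lindbladian hH L).smul _).exp _ _
  · rw [observable, rhoApprox, if_neg hτ'.ne']
    have hdual : IsTraceDual (superLog (krausStep H L τ))
        ((τ : ℂ) • logQuotient (dualLindbladian H L) (dualSecondOrder H L) τ) := by
      rw [smul_logQuotient (𝔸 := SuperOp n)]
      refine IsTraceDual.hasSum (fun m => ?_) (summable_log_series (𝔸 := SuperOp n) hK).hasSum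
        (summable_log_series (𝔸 := SuperOp n) hK').hasSum
      refine IsTraceDual.smul (IsTraceDual.pow ?_ _) _
      rw [krausStep_eq H hH L hτ, add_assoc, add_sub_cancel_left]
      exact ((isTraceDual_lindbladian hH L).smul _).add ((isTraceDual_secondOrder H L).smul _)
    have hτc : ((T / τ : ℝ) : ℂ) * (τ : ℂ) = T := by
      rw [← Complex.ofReal_mul, div_mul_cancel₀ _ hτ'.ne']
    have := (hdual.smul ((T / τ : ℝ) : ℂ)).exp ρ₀ O
    rwa [smul_smul, hτc] at this

lemma norm_krausStep_sub_one_le {H : Matrix n n ℂ} (hH : H.IsHermitian) (L : ι → Matrix n n ℂ)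
    {τ : ℝ} (hτ : 0 ≤ τ) :
    ‖krausStep H L τ - 1‖ ≤ τ * lindbladBound H L + (τ * ‖effective H L‖) ^ 2 := by
  rw [krausStep_eq H hH L hτ, add_assoc, add_sub_cancel_left]
  refine (norm_add_le _ _).trans ?_
  rw [norm_smul, norm_smul, norm_pow, Complex.norm_real, Real.norm_eq_abs, abs_of_nonneg hτ,
    mul_pow]
  gcongr
  · exact norm_lindbladian_le hH L
  · exact norm_secondOrder_le H L

/-- `exp (N log K) = K ^ N` for `K` close to the identity. -/
lemma agreesWithScheme_of_norm_lt {H : Matrix n n ℂ} {L : ι → Matrix n n ℂ} {R : ℝ}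
    (hK : ∀ τ, 0 < τ → τ ≤ R → ‖krausStep H L τ - 1‖ < 1) (ρ₀ : Matrix n n ℂ) (T : ℝ) :
    AgreesWithScheme H L ρ₀ T R := by
  intro τ hτ hτR
  refine ⟨summable_log_series (𝔸 := SuperOp n) (hK τ hτ hτR), fun N hN => ?_⟩
  have hlog : NormedSpace.exp (superLog (krausStep H L τ)) = krausStep H L τ := by
    have := exp_log_series (𝔸 := SuperOp n) (hK τ hτ hτR)
    rw [add_sub_cancel] at this
    exact this
  have hTN : T / τ = N := by rw [← hN, mul_div_cancel_right₀ _ hτ.ne']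
  rw [rhoApprox, if_neg hτ.ne', hTN, Complex.ofReal_natCast,
    exp_natCast_smul (𝔸 := SuperOp n), hlog]

/-- The constants `0.106` and `0.0286` are slightly larger than `1 / (2 (e + 2))` and
`1 / (2 (e + 1) (e + 2))`, the ratios which the definitions of `C₁`, `C₂` and `ν` provide. With
these hypotheses the lemma applies to the original and to the rescaled data alike. -/
lemma gevrey_of_bounds {H : Matrix n n ℂ} (hH : H.IsHermitian) (L : ι → Matrix n n ℂ)
    {ρ₀ : Matrix n n ℂ} (hρ₀ : ρ₀.PosSemidef) (htr : ρ₀.trace = 1) (O : Matrix n n ℂ)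
    {T ν R : ℝ} (hT : 0 ≤ T) (hν : 0 < ν) (hR : 0 < R) (hRν : R ≤ 1 / (2 * ν))
    (hTA : T * ‖effective H L‖ ^ 2 ≤ 0.106 * ν) (hl : lindbladBound H L ≤ 0.0286 * ν) :
    AgreesWithScheme H L ρ₀ T R ∧ IsGevreyOn 1 (observable H L ρ₀ O T) R ∧
      GevreyBound (observable H L ρ₀ O T) (2 * Real.exp 1 * ‖O‖) ν R := by
  have hA : ‖effective H L‖ ≤ 0.0143 * ν := by linarith [norm_effective_le H L]
  have hstep : ∀ τ, 0 ≤ τ → τ ≤ R → τ * ν ≤ 1 / 2 := fun τ _ hτR => by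
    have := hτR.trans hRν
    rw [le_div_iff₀ (by positivity)] at this
    linarith
  have hτA : ∀ τ, 0 ≤ τ → τ ≤ R → τ * ‖effective H L‖ ≤ 0.01 := fun τ h0 hτR => by
    have h1 := mul_le_mul_of_nonneg_left hA h0
    linarith [hstep τ h0 hτR]
  have hK : ∀ τ, 0 ≤ τ → τ ≤ R → ‖krausStep H L τ - 1‖ < 1 := fun τ h0 hτR => by
    refine (norm_krausStep_sub_one_le hH L h0).trans_lt ?_
    have h1 := mul_le_mul_of_nonneg_left hl h0
    have h2 : 0 ≤ τ * ‖effective H L‖ := by positivity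
    nlinarith [hstep τ h0 hτR, hτA τ h0 hτR]
  have hK' : ∀ τ, 0 ≤ τ → τ ≤ R →
      ‖(τ : ℂ) • dualLindbladian H L + (τ : ℂ) ^ 2 • dualSecondOrder H L‖ < 1 := fun τ h0 hτR => by
    have hz : (τ : ℂ) • dualLindbladian H L + (τ : ℂ) ^ 2 • dualSecondOrder H L
        = (τ : ℂ) • (dualLindbladian H L + (τ : ℂ) • dualSecondOrder H L) := by
      ext1 X
      simp only [add_apply, smul_apply, smul_add, smul_smul, pow_two]
    rw [hz, norm_smul, Complex.norm_real, Real.norm_eq_abs, abs_of_nonneg h0]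
    have h1 := norm_dualLindbladian_add_smul_le hH L (z := (τ : ℂ)) (q := τ)
      (by rw [Complex.norm_real, Real.norm_eq_abs, abs_of_nonneg h0])
    have h2 := mul_le_mul_of_nonneg_left h1 h0
    have h3 : 0 ≤ τ * ‖effective H L‖ := by positivity
    nlinarith [hτA τ h0 hτR]
  refine ⟨agreesWithScheme_of_norm_lt (fun τ h0 => hK τ h0.le) ρ₀ T, ?_⟩
  refine gevrey_of_differentiableOn (g := fun z => (ρ₀ * NormedSpace.exp
      ((T : ℂ) • logQuotient (dualLindbladian H L) (dualSecondOrder H L) z) O).trace)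
    hR hν hRν ?_ (fun z hz => ?_) fun τ hτ =>
      observable_eq hH L ρ₀ O T hτ.1 (hK τ hτ.1 hτ.2) (hK' τ hτ.1 hτ.2)
  · have hcomp := differentiableOn_exp_smul_logQuotient (𝔸 := SuperOp n) (G := dualLindbladian H L)
      (M := dualSecondOrder H L) (q := 2 / ν)
      (s := ‖effective H L‖ * (4 + 2 / ν * ‖effective H L‖)) (by
        have h1 : 2 / ν * ‖effective H L‖ ≤ 0.0286 := by
          rw [div_mul_eq_mul_div, div_le_iff₀ hν]; linarith
        have h0 : 0 ≤ 2 / ν * ‖effective H L‖ := by positivity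
        nlinarith) (by positivity)
      (fun z hz => norm_dualLindbladian_add_smul_le hH L hz.le) (T : ℂ)
    have hlin : Differentiable ℂ fun Z : SuperOp n => (ρ₀ * Z O).trace := by
      let Ψ : SuperOp n →ₗ[ℂ] ℂ :=
        { toFun := fun Z => (ρ₀ * Z O).trace
          map_add' := fun P Q => by rw [add_apply, mul_add, Matrix.trace_add]
          map_smul' := fun c P => by
            rw [smul_apply, mul_smul_comm, Matrix.trace_smul, RingHom.id_apply] }
      exact (LinearMap.toContinuousLinearMap Ψ).differentiable
    exact Differentiable.comp_differentiableOn (g := fun Z : SuperOp n => (ρ₀ * Z O).trace)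
      hlin hcomp
  · refine (norm_trace_mul_le_of_posSemidef hρ₀ htr _).trans ?_
    refine (ContinuousLinearMap.le_opNorm _ _).trans ?_
    gcongr
    exact norm_exp_smul_logQuotient_le hH L hT hν hTA hA hz

end Scheme

/-! ### The constants -/

section Constants

/-- The bound `log (e + 1) ≥ 1 + 1 / (e + 1)` makes `C₂ ≥ e + 2`. -/
lemma exp_one_add_two_le {C₁ C₂ : ℝ} (hC₁ : Real.exp 1 + 1 ≤ C₁)
    (hC₂ : (Real.exp 1 + 1) * Real.log C₁ ≤ C₂) : Real.exp 1 + 2 ≤ C₂ := by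
  have he : 0 < Real.exp 1 := Real.exp_pos 1
  have h1 : Real.log (Real.exp 1 + 1) ≤ Real.log C₁ := Real.log_le_log (by positivity) hC₁
  have h2 := Real.one_sub_inv_le_log_of_pos (show 0 < (Real.exp 1 + 1) / Real.exp 1 by positivity)
  rw [Real.log_div (by positivity) he.ne', Real.log_exp, inv_div] at h2
  have h3 : Real.exp 1 + 2 = (Real.exp 1 + 1) * (2 - Real.exp 1 / (Real.exp 1 + 1)) := by
    field_simp; ring
  calc Real.exp 1 + 2 = (Real.exp 1 + 1) * (2 - Real.exp 1 / (Real.exp 1 + 1)) := h3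
    _ ≤ (Real.exp 1 + 1) * Real.log C₁ := by gcongr; linarith
    _ ≤ C₂ := hC₂

lemma sq_le_timeFactor (T : ℝ) : T ^ 2 ≤ timeFactor T :=
  le_mul_of_one_le_right (sq_nonneg T) (le_max_left _ _)

end Constants

end LindbladKraus

end

theorem mainTheorem3 {n ι : Type*} [Fintype n] [DecidableEq n] [Fintype ι]
    (H : Matrix n n ℂ) (hH : H.IsHermitian) (L : ι → Matrix n n ℂ)
    (ρ₀ : Matrix n n ℂ) (hρ₀ : ρ₀.PosSemidef) (hρ₀_trace : ρ₀.trace = 1)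
    (O : Matrix n n ℂ) (hO : O.IsHermitian)
    (l : ℝ) (hl_one : 1 ≤ l) (hl : LindbladKraus.lindbladBound H L ≤ l)
    (C₁ C₂ : ℝ) (hC₁ : C₁ = LindbladKraus.constC₁ H L l)
    (hC₂ : (Real.exp 1 + 1) * Real.log C₁ ≤ C₂)
    (σ ν : ℝ) (hσ : σ = 2 * Real.exp 1 * ‖O‖) (hν : ν = 2 * C₁ * C₂)
    (τmax : ℝ) (hτmax_pos : 0 < τmax) (hτmax : τmax ≤ 1 / (2 * ν)) (T : ℝ) :
    (0 ≤ T → T ≤ 1 →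
      LindbladKraus.AgreesWithScheme H L ρ₀ T τmax ∧
      LindbladKraus.IsGevreyOn 1 (LindbladKraus.observable H L ρ₀ O T) τmax ∧
      LindbladKraus.GevreyBound (LindbladKraus.observable H L ρ₀ O T) σ ν τmax) ∧
    (1 ≤ T →
      -- the scheme for the rescaled equation, run up to time `1`, step size in rescaled time
      (LindbladKraus.AgreesWithScheme (LindbladKraus.scaledH H T) (LindbladKraus.scaledL L T)
          ρ₀ 1 (τmax / LindbladKraus.timeFactor T) ∧
        LindbladKraus.IsGevreyOn 1
          (LindbladKraus.observable (LindbladKraus.scaledH H T) (LindbladKraus.scaledL L T)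
            ρ₀ O 1)
          (τmax / LindbladKraus.timeFactor T) ∧
        LindbladKraus.GevreyBound
          (LindbladKraus.observable (LindbladKraus.scaledH H T) (LindbladKraus.scaledL L T)
            ρ₀ O 1)
          σ (ν * LindbladKraus.timeFactor T) (τmax / LindbladKraus.timeFactor T)) ∧
      -- the scheme for the original equation, run up to time `T`
      (LindbladKraus.AgreesWithScheme H L ρ₀ T (τmax / LindbladKraus.timeFactor T) ∧
        LindbladKraus.IsGevreyOn 1 (LindbladKraus.observable H L ρ₀ O T)
          (τmax / LindbladKraus.timeFactor T) ∧
        LindbladKraus.GevreyBound (LindbladKraus.observable H L ρ₀ O T)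
          σ (ν * LindbladKraus.timeFactor T) (τmax / LindbladKraus.timeFactor T))) := by
  subst hσ
  have he : 2.718 < Real.exp 1 := by linarith [Real.exp_one_gt_d9]
  have hB : LindbladKraus.superNorm (LindbladKraus.secondOrder H L) ≤ C₁ :=
    hC₁ ▸ (le_max_left _ _).trans (le_max_left _ _)
  have hlC : l * (Real.exp 1 + 1) ≤ C₁ := hC₁ ▸ (le_max_right _ _).trans (le_max_left _ _)
  have hC₁e : Real.exp 1 + 1 ≤ C₁ := by nlinarith
  have hC₂e : 4.718 ≤ C₂ := by linarith [LindbladKraus.exp_one_add_two_le hC₁e hC₂]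
  have hC₁0 : 0 < C₁ := by linarith
  have hν1 : C₁ ≤ 0.106 * ν := by rw [hν]; nlinarith
  have hν0 : 0 < ν := by linarith
  have hA : ‖LindbladKraus.effective H L‖ ^ 2 ≤ 0.106 * ν :=
    (LindbladKraus.norm_effective_sq_le_superNorm H L).trans (hB.trans hν1)
  -- `l ≤ C₁ / (e + 1)`, because `C₁ ≥ l (e + 1)`.
  have hlb : LindbladKraus.lindbladBound H L ≤ 0.0286 * ν := by
    have h1 : l * 3.718 ≤ C₁ := le_trans (by gcongr; linarith) hlC
    linarith
  have hlb0 := LindbladKraus.lindbladBound_nonneg H L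
  refine ⟨fun h0 h1 => ?_, fun hT => ?_⟩
  · refine LindbladKraus.gevrey_of_bounds hH L hρ₀ hρ₀_trace O h0 hν0 hτmax_pos hτmax ?_ hlb
    exact (mul_le_of_le_one_left (sq_nonneg _) h1).trans hA
  · set lam := LindbladKraus.timeFactor T
    have hTlam : T ^ 2 ≤ lam := LindbladKraus.sq_le_timeFactor T
    have hT0 : 0 ≤ T := by linarith
    have hTT : T ≤ lam := by nlinarith
    have hlam : 1 ≤ lam := hT.trans hTT
    have hlam0 : 0 < lam := by linarith
    have hνlam : 0 < ν * lam := by positivity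
    have hR : τmax / lam ≤ 1 / (2 * (ν * lam)) := by
      rw [← mul_assoc, ← div_div]
      gcongr
    have hRpos : 0 < τmax / lam := by positivity
    refine ⟨?_, ?_⟩
    · refine LindbladKraus.gevrey_of_bounds (LindbladKraus.isHermitian_scaledH hH T)
        (LindbladKraus.scaledL L T) hρ₀ hρ₀_trace O zero_le_one hνlam hRpos hR ?_ ?_
      · rw [LindbladKraus.effective_scaled H L hT0, norm_smul, Complex.norm_real, Real.norm_eq_abs,
          abs_of_nonneg hT0, one_mul, mul_pow]
        have := mul_le_mul hTlam hA (sq_nonneg _) hlam0.le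
        linarith
      · rw [LindbladKraus.lindbladBound_scaled H L hT0]
        have := mul_le_mul hTT hlb hlb0 hlam0.le
        linarith
    · refine LindbladKraus.gevrey_of_bounds hH L hρ₀ hρ₀_trace O hT0 hνlam hRpos hR ?_ ?_
      · have := mul_le_mul hTT hA (sq_nonneg _) hlam0.le
        linarith
      · exact hlb.trans (by nlinarith)
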